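/- Let $n\ge 1$ and let $\mathfrak g_1,\dots,\mathfrak g_n$ be complex semisimple (in particular, simple) Lie algebras, with Cartan matrices $(a_{ij})$ and numbers $d_i=(\alpha_i,\alpha_i)/2\in\mathbb Q_{>0}$. For such $\mathfrak g$ let $U_h(\mathfrak g)$ be the $h$-adic Drinfeld–Jimbo algebra over $\mathbb C[[h]]$ with generators $H_i,E_i,F_i$, $q=e^h$, $q_i=e^{d_ih}$, $K_i=e^{d_ihH_i}$, with antipode $S(H_i)=-H_i$, $S(E_i)=-E_iK_i^{-1}$, $S(F_i)=-K_iF_i$, and with universal $R$-matrix $$\mathscr R=\exp\Bigl(h\sum_{i,j}B_{ij}H_i\otimes H_j\Bigr)\prod_{\beta\in\Delta_+}\exp_{q_\beta}\bigl((1-q_\beta^{-2})E_\beta\otimes F_\beta\bigr)\in U_h(\mathfrak g)\hat\otimes U_h(\mathfrak g),$$ where $B=(a_{ij}/d_j)^{-1}$, $\exp_q x=\sum_r \frac{q^{r(r+1)/2}}{[r]_q!}x^r$, and the root vectors and the order of the product are those given by Lusztig's automorphisms and a reduced expression of the longest Weyl group element. (For each $\mathfrak g_i$ fix a reduced expression;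 for $\mathfrak g_1\oplus\dots\oplus\mathfrak g_n$ use any reduced expression whose subword of letters from the $i$-th block is the chosen one for $\mathfrak g_i$, for every $i$.) For a representation $T$ of $U_h(\mathfrak g)$ on a free $\mathbb C[[h]]$-module $V$ of finite rank with basis $(x_j)$, define $l^{\pm}_{kj}\in U_h(\mathfrak g)$ by $$(\mathrm{id}\otimes T)(\mathscr R)(1\otimes x_j)=\sum_k l^+_{kj}\otimes x_k,\qquad (T\otimes \mathrm{id})(\mathscr R^{-1})(x_j\otimes 1)=\sum_k x_k\otimes l^-_{kj},$$ and the FRT generators by $(m^\pm)^k_j=S(l^\pm_{kj})$. For a subfield $k\subseteq\mathbb C((h))$ let $U_q^{\rm ext}(\mathfrak g)$ be the $k$-subalgebra of $\mathbb C((h))\otimes_{\mathbb C[[h]]}U_h(\mathfrak g)$ generated by the $(m^\pm)^k_j$. Let $T_{V_i}$ be a representation of $U_h(\mathfrak g_i)$ on a free $\mathbb C[[h]]$-module $V_i$ of finite rank with a fixed basis $(x^{(i)}_j)_j$ (in particular, any minuscule irreducible one), $i=1,\dots,n$. Then there is an isomorphism of $\mathbb C[[h]]$-algebras $$\Phi:\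 U_h(\mathfrak g_1\oplus\dots\oplus\mathfrak g_n)\ \xrightarrow{\ \sim\ }\ U_h(\mathfrak g_1)\hat\otimes\cdots\hat\otimes U_h(\mathfrak g_n)$$ that maps each generator $H_a,E_a,F_a$ belonging to $\mathfrak g_i$ to $1\otimes\dots\otimes H_a\otimes\dots\otimes 1$, etc. (in the $i$-th factor); there is exactly one representation $T_{V_1\otimes\cdots\otimes V_n}$ of $U_h(\mathfrak g_1\oplus\dots\oplus\mathfrak g_n)$ on $V_1\otimes\dots\otimes V_n$ in which $\Phi^{-1}(u_1\otimes\dots\otimes u_n)$ acts as $T_{V_1}(u_1)\otimes\dots\otimes T_{V_n}(u_n)$; and its FRT generators with respect to the basis $x_{\underline j}=x^{(1)}_{j_1}\otimes\dots\otimes x^{(n)}_{j_n}$ satisfy, for all $\underline k=(k_1,\dots,k_n)$ and $\underline j=(j_1,\dots,j_n)$, $$\Phi\bigl((m^{+})^{\underline k}_{\underline j}\bigr)=(m^{+})^{k_1}_{j_1}\otimes\cdots\otimes(m^{+})^{k_n}_{j_n},\qquad \Phi\bigl((m^{-})^{\underline k}_{\underline j}\bigr)=(m^{-})^{k_1}_{j_1}\otimes\cdots\otimes(m^{-})^{k_n}_{j_n}.$$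 Consequently, for every such $k$, $\Phi$ (extended to $\mathbb C((h))$) maps the algebra $U_q^{\rm ext}(\mathfrak g_1\oplus\dots\oplus\mathfrak g_n)$ generated by the FRT generators of $T_{V_1\otimes\cdots\otimes V_n}$ onto the $k$-subalgebra generated by the elements $(m^{\pm})^{k_1}_{j_1}\otimes\cdots\otimes(m^{\pm})^{k_n}_{j_n}$ (all signs equal). -/

import Mathlib

set_option linter.unusedSectionVars false

open scoped TensorProduct

noncomputable section

namespace QG

/-- The ground ring `ℂ[[h]]`; the variable `PowerSeries.X` is `h`. -/
abbrev Kh : Type := PowerSeries ℂ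

/-- The scalar `q^c = e^{c h}` of `ℂ[[h]]`, where `q = e^h`. -/
def qpow (c : ℚ) : Kh := PowerSeries.mk fun k => (c : ℂ) ^ k / (k.factorial : ℂ)

/-- The quotient of a power series by `h`, for series without constant term. -/
def divh (f : Kh) : Kh := PowerSeries.mk fun k => PowerSeries.coeff (k + 1) f

/-- The `q^c`-integer `[n] = (q^{cn} - q^{-cn}) / (q^c - q^{-c}) = ∑_{k<n} q^{c(n-1-2k)}`. -/
def qint (c : ℚ) (n : ℕ) : Kh := ∑ k ∈ Finset.range n, qpow (c * ((n : ℚ) - 1 - 2 * k))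

/-- The `q^c`-factorial `[n]!`; it is a unit of `ℂ[[h]]`. -/
def qfact (c : ℚ) (n : ℕ) : Kh := ∏ k ∈ Finset.range n, qint c (k + 1)

/-- The `q^c`-binomial coefficient. -/
def qbinom (c : ℚ) (n r : ℕ) : Kh := qfact c n * (qfact c r)⁻¹ * (qfact c (n - r))⁻¹

section series

variable {C C' : Type*} [Ring C] [Algebra Kh C] [Ring C'] [Algebra Kh C']

/-- `e^{c h x}`, in an algebra in which `h ^ N = 0`. -/
def hexp (N : ℕ) (c : ℚ) (x : C) : C :=
  ∑ k ∈ Finset.range N, PowerSeries.monomial k ((c : ℂ) ^ k / (k.factorial : ℂ)) • x ^ k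

/-- `(e^{c h x} - e^{- c h x}) / (e^{c h} - e^{- c h})`, in an algebra in which `h ^ N = 0`:
numerator and denominator are both divided by `h`. -/
def hquot (N : ℕ) (c : ℚ) (x : C) : C :=
  (divh (qpow c - qpow (-c)))⁻¹ • ∑ k ∈ Finset.range N,
    PowerSeries.monomial k (((c : ℂ) ^ (k + 1) - (-(c : ℂ)) ^ (k + 1)) / ((k + 1).factorial : ℂ)) •
      x ^ (k + 1)

/-- The `q`-exponential `exp_{q^c} z = ∑_r q^{c r (r + 1) / 2} / [r]! z ^ r`, for an element `z`
divisible by `h` of an algebra in which `h ^ N = 0`. -/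
def qExp (N : ℕ) (c : ℚ) (z : C) : C :=
  ∑ r ∈ Finset.range N, (qpow (c * (r * (r + 1) / 2)) * (qfact c r)⁻¹) • z ^ r

/-- The `q`-Serre expression `∑_r (-1)^r [n choose r] x^{n-r} y x^r`. -/
def serre (n : ℕ) (c : ℚ) (x y : C) : C :=
  ∑ r ∈ Finset.range (n + 1), ((-1) ^ r * qbinom c n r) • (x ^ (n - r) * y * x ^ r)

theorem map_hexp (f : C →ₐ[Kh] C') (N : ℕ) (c : ℚ) (x : C) :
    f (hexp N c x) = hexp N c (f x) := by
  simp [hexp]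

theorem map_hquot (f : C →ₐ[Kh] C') (N : ℕ) (c : ℚ) (x : C) :
    f (hquot N c x) = hquot N c (f x) := by
  simp [hquot]

theorem map_qExp (f : C →ₐ[Kh] C') (N : ℕ) (c : ℚ) (x : C) :
    f (qExp N c x) = qExp N c (f x) := by
  simp [qExp]

theorem map_serre (f : C →ₐ[Kh] C') (n : ℕ) (c : ℚ) (x y : C) :
    f (serre n c x y) = serre n c (f x) (f y) := by
  simp [serre]

theorem hpow_smul {N : ℕ} (hN : algebraMap Kh C (PowerSeries.X ^ N) = 0) (x : C) :
    (PowerSeries.X ^ N : Kh) • x = 0 := by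
  rw [Algebra.smul_def, hN, zero_mul]

theorem monomial_smul {N : ℕ} (hN : algebraMap Kh C (PowerSeries.X ^ N) = 0) (a : ℂ) (x : C)
    {k : ℕ} (hk : N ≤ k) : (PowerSeries.monomial k a : Kh) • x = 0 := by
  obtain ⟨j, rfl⟩ := Nat.exists_eq_add_of_le hk
  have : (PowerSeries.monomial (N + j) a : Kh) = PowerSeries.X ^ N * PowerSeries.monomial j a := by
    rw [PowerSeries.X_pow_eq, PowerSeries.monomial_mul_monomial, one_mul]
  rw [this, mul_smul, hpow_smul hN]

theorem hexp_succ {N : ℕ} (hN : algebraMap Kh C (PowerSeries.X ^ N) = 0) (c : ℚ) (x : C) :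
    hexp (N + 1) c x = hexp N c x := by
  rw [hexp, Finset.sum_range_succ, monomial_smul hN _ _ le_rfl, add_zero, hexp]

theorem hquot_succ {N : ℕ} (hN : algebraMap Kh C (PowerSeries.X ^ N) = 0) (c : ℚ) (x : C) :
    hquot (N + 1) c x = hquot N c x := by
  rw [hquot, Finset.sum_range_succ, monomial_smul hN _ _ le_rfl, add_zero, hquot]

theorem qpow_eq (c : ℚ) : qpow c = PowerSeries.rescale (c : ℂ) (PowerSeries.exp ℂ) := by
  ext k; simp [qpow, PowerSeries.coeff_rescale, PowerSeries.coeff_exp, div_eq_mul_inv]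

theorem qpow_add (a b : ℚ) : qpow (a + b) = qpow a * qpow b := by
  rw [qpow_eq, qpow_eq, qpow_eq, PowerSeries.exp_mul_exp_eq_exp_add]; push_cast; rfl

theorem qpow_zero : qpow 0 = 1 := by
  ext k; cases k <;> simp [qpow, PowerSeries.coeff_one]

theorem hexp_eq_exp [Module ℚ C] [IsScalarTower ℚ Kh C] {N : ℕ}
    (hN : algebraMap Kh C (PowerSeries.X ^ N) = 0) (c : ℚ) (x : C) :
    hexp N c x = IsNilpotent.exp ((PowerSeries.monomial 1 (c : ℂ) : Kh) • x) ∧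
      IsNilpotent ((PowerSeries.monomial 1 (c : ℂ) : Kh) • x) := by
  have key : ∀ k, ((PowerSeries.monomial 1 (c : ℂ) : Kh) • x) ^ k
      = (PowerSeries.monomial k ((c : ℂ) ^ k) : Kh) • x ^ k := by
    intro k
    rw [smul_pow, PowerSeries.monomial_pow]; simp
  have h0 : ((PowerSeries.monomial 1 (c : ℂ) : Kh) • x) ^ N = 0 := by
    rw [key, monomial_smul hN _ _ le_rfl]
  refine ⟨?_, N, h0⟩
  rw [IsNilpotent.exp_eq_sum h0, hexp]
  refine Finset.sum_congr rfl fun k _ => ?_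
  rw [key, ← smul_assoc]
  congr 1
  have : ∀ (q : ℚ) (f : Kh), q • f = (q : ℂ) • f := fun q f => PowerSeries.ext (congrFun rfl)
  rw [this, div_eq_inv_mul, ← smul_eq_mul, map_smul]
  push_cast
  rfl

theorem hexp_add_of_commute {N : ℕ} (hN : algebraMap Kh C (PowerSeries.X ^ N) = 0) (a b c : ℚ)
    (x y z : C) (hxy : Commute x y)
    (hz : (PowerSeries.monomial 1 (c : ℂ) : Kh) • z = (PowerSeries.monomial 1 (a : ℂ) : Kh) • x +
      (PowerSeries.monomial 1 (b : ℂ) : Kh) • y) :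
    hexp N c z = hexp N a x * hexp N b y := by
  let _ : Module ℚ C := Module.compHom C (algebraMap ℚ Kh)
  have _ : IsScalarTower ℚ Kh C := ⟨fun q f x => by
    change _ = (algebraMap ℚ Kh q) • f • x
    rw [← mul_smul, ← Algebra.smul_def]⟩
  obtain ⟨h1, n1⟩ := hexp_eq_exp hN a x
  obtain ⟨h2, n2⟩ := hexp_eq_exp hN b y
  obtain ⟨h3, n3⟩ := hexp_eq_exp hN c z
  rw [h1, h2, h3, hz, IsNilpotent.exp_add_of_commute _ n1 n2]
  exact (hxy.smul_left _).smul_right _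

theorem hexp_mul {N : ℕ} (hN : algebraMap Kh C (PowerSeries.X ^ N) = 0) (a b : ℚ) (x : C) :
    hexp N a x * hexp N b x = hexp N (a + b) x := by
  refine (hexp_add_of_commute hN a b (a + b) x x x (Commute.refl x) ?_).symm
  rw [← add_smul, ← map_add]; push_cast; rfl

theorem hexp_zero {N : ℕ} (hN : algebraMap Kh C (PowerSeries.X ^ N) = 0) (x : C) :
    hexp N 0 x = 1 := by
  cases N with
  | zero =>
    have h1 : (1 : C) = 0 := by simpa using hN
    simp [hexp, h1]
  | succ N =>
    rw [hexp, Finset.sum_range_succ', Finset.sum_eq_zero]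
    · simp [PowerSeries.monomial_zero_eq_C]
    · intro k _
      simp

theorem hexp_neg_mul {N : ℕ} (hN : algebraMap Kh C (PowerSeries.X ^ N) = 0) (c : ℚ) (x : C) :
    hexp N (-c) x * hexp N c x = 1 := by
  rw [hexp_mul hN, neg_add_cancel, hexp_zero hN]

theorem hexp_mul_neg {N : ℕ} (hN : algebraMap Kh C (PowerSeries.X ^ N) = 0) (c : ℚ) (x : C) :
    hexp N c x * hexp N (-c) x = 1 := by
  rw [hexp_mul hN, add_neg_cancel, hexp_zero hN]

theorem qpow_smul {N : ℕ} (hN : algebraMap Kh C (PowerSeries.X ^ N) = 0) (c : ℚ) :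
    hexp N c (1 : C) = qpow c • (1 : C) := by
  have h : ∃ g : Kh, qpow c = (∑ k ∈ Finset.range N,
      PowerSeries.monomial k ((c : ℂ) ^ k / (k.factorial : ℂ))) + PowerSeries.X ^ N * g := by
    refine ⟨PowerSeries.mk fun j => PowerSeries.coeff (j + N) (qpow c), ?_⟩
    ext m
    rw [map_add, map_sum, PowerSeries.coeff_X_pow_mul']
    simp only [PowerSeries.coeff_monomial]
    by_cases hm : N ≤ m
    · simp [hm, Finset.mem_range, qpow]
    · simp [hm, Finset.mem_range, qpow]
  obtain ⟨g, hg⟩ := h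
  rw [hg, add_smul, mul_smul, hpow_smul hN, add_zero, Finset.sum_smul]
  simp [hexp]

theorem hexp_semiconj {N : ℕ} (hN : algebraMap Kh C (PowerSeries.X ^ N) = 0) (c : ℚ) (a : ℤ)
    {x e : C} (h : x * e - e * x = a • e) :
    hexp N c x * e = qpow (c * a) • (e * hexp N c x) := by
  have h1 : SemiconjBy e (x + (a : C)) x := by
    have : (a : C) = a • (1 : C) := by simp
    rw [SemiconjBy, this, mul_add, mul_smul_comm, mul_one, ← h]; abel
  have h2 : e * hexp N c (x + (a : C)) = hexp N c x * e := by
    simp only [hexp, Finset.mul_sum, Finset.sum_mul, mul_smul_comm, smul_mul_assoc]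
    refine Finset.sum_congr rfl fun k _ => ?_
    rw [(h1.pow_right k).eq]
  have h3 : hexp N c (x + (a : C)) = hexp N c x * hexp N (c * a) (1 : C) := by
    refine hexp_add_of_commute hN c (c * a) c x 1 _ (Commute.one_right x) ?_
    rw [smul_add]
    congr 1
    have : (a : C) = a • (1 : C) := by simp
    rw [this, smul_comm, ← smul_assoc, ← map_zsmul]
    congr 2
    push_cast; rw [zsmul_eq_mul]; ring
  rw [← h2, h3, qpow_smul hN]
  simp

theorem commute_hexp {N : ℕ} (c : ℚ) {x y : C} (h : Commute x y) : Commute (hexp N c x) y := by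
  refine Commute.sum_left _ _ _ fun k _ => ?_
  exact (h.pow_left k).smul_left _

theorem hquot_neg (N : ℕ) (c : ℚ) (x : C) : hquot N c (-x) = - hquot N c x := by
  simp only [hquot, ← smul_neg, ← Finset.sum_neg_distrib]
  congr 1
  refine Finset.sum_congr rfl fun k _ => ?_
  rcases Nat.even_or_odd (k + 1) with hk | hk
  · rw [hk.neg_pow, hk.neg_pow]; simp
  · rw [hk.neg_pow x, smul_neg]

theorem commute_hquot {N : ℕ} (c : ℚ) {x y : C} (h : Commute x y) : Commute (hquot N c x) y := by
  refine Commute.smul_left (Commute.sum_left _ _ _ fun k _ => ?_) _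
  exact (h.pow_left _).smul_left _

theorem qbinom_symm (c : ℚ) {n r : ℕ} (h : r ≤ n) : qbinom c n (n - r) = qbinom c n r := by
  rw [qbinom, qbinom, Nat.sub_sub_self h]; ring

theorem serre_smul (n : ℕ) (c : ℚ) (a b : Kh) (x y : C) :
    serre n c (a • x) (b • y) = (a ^ n * b) • serre n c x y := by
  rw [serre, serre, Finset.smul_sum]
  refine Finset.sum_congr rfl fun r hr => ?_
  have hr' : r ≤ n := Nat.lt_succ_iff.mp (Finset.mem_range.mp hr)
  rw [smul_pow, smul_pow]
  simp only [smul_mul_assoc, mul_smul_comm, smul_smul]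
  congr 1
  rw [← Nat.sub_add_cancel hr', pow_add, Nat.sub_add_cancel hr']; ring

theorem twist_pow {a : Kh} {x k : C} (h : k * x = a • (x * k)) (r : ℕ) :
    k ^ r * x = a ^ r • (x * k ^ r) := by
  induction r with
  | zero => simp
  | succ r ih =>
    rw [pow_succ, mul_assoc, h, mul_smul_comm, ← mul_assoc, ih, smul_mul_assoc, smul_smul,
      mul_assoc, pow_succ, mul_comm]

theorem twist_pow' {a : Kh} {x k : C} (h : k * x = a • (x * k)) (r s : ℕ) :
    k ^ r * x ^ s = a ^ (r * s) • (x ^ s * k ^ r) := by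
  induction s with
  | zero => simp
  | succ s ih =>
    rw [pow_succ, ← mul_assoc, ih, smul_mul_assoc, mul_assoc, twist_pow h, mul_smul_comm, smul_smul,
      ← mul_assoc, ← pow_add, Nat.mul_succ]

theorem twist_mul_pow {a : Kh} {x k : C} (h : k * x = a • (x * k)) (r : ℕ) :
    (x * k) ^ r = a ^ (r.choose 2) • (x ^ r * k ^ r) := by
  induction r with
  | zero => simp
  | succ r ih =>
    rw [pow_succ, ih, smul_mul_assoc, mul_assoc, ← mul_assoc (k ^ r), twist_pow h, smul_mul_assoc,
      mul_smul_comm, smul_smul, ← pow_add, Nat.choose_succ_succ', Nat.choose_one_right, pow_succ,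
      pow_succ, add_comm r]
    simp only [mul_assoc]

theorem twist_word {a b : Kh} {x y k l : C} (hx : k * x = a • (x * k)) (hy : k * y = b • (y * k))
    (hl : l * x = b • (x * l)) (hkl : Commute k l) (r s : ℕ) :
    (x * k) ^ r * (y * l) * (x * k) ^ s =
      (a ^ ((r + s).choose 2) * b ^ (r + s)) • (x ^ r * y * x ^ s * (k ^ (r + s) * l)) := by
  have hl' : l * x ^ s = b ^ s • (x ^ s * l) := by
    simpa using twist_pow' hl 1 s
  have e : (r + s).choose 2 = r.choose 2 + s.choose 2 + r * s := by
    rw [Nat.add_choose_eq]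
    simp [Finset.Nat.antidiagonal_succ]
    ring
  rw [twist_mul_pow hx, twist_mul_pow hx, e]
  calc _ = (a ^ r.choose 2 * a ^ s.choose 2) • (x ^ r * ((k ^ r * y) * (l * x ^ s)) * k ^ s) := by
        simp only [smul_mul_assoc, mul_smul_comm, smul_smul, mul_assoc]
        rw [mul_comm]
    _ = (a ^ r.choose 2 * a ^ s.choose 2 * b ^ r * b ^ s) •
          (x ^ r * y * ((k ^ r * x ^ s) * l) * k ^ s) := by
        rw [twist_pow hy, hl']
        simp only [smul_mul_assoc, mul_smul_comm, smul_smul, mul_assoc]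
        congr 1; ring
    _ = _ := by
        rw [twist_pow' hx]
        simp only [smul_mul_assoc, mul_smul_comm, smul_smul, mul_assoc]
        rw [← (hkl.pow_left s).eq, ← mul_assoc (k ^ r), ← pow_add]
        congr 1; ring

/-- The antipode respects the `q`-Serre expressions. -/
theorem serre_twist {a b : Kh} {x y k l : C} (n : ℕ) (c : ℚ) (hx : k * x = a • (x * k))
    (hy : k * y = b • (y * k)) (hl : l * x = b • (x * l)) (hkl : Commute k l)
    (h : serre n c x y = 0) :
    serre n c (MulOpposite.op (-(x * k))) (MulOpposite.op (-(y * l))) = 0 := by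
  apply MulOpposite.unop_injective
  have e : MulOpposite.unop (serre n c (MulOpposite.op (-(x * k))) (MulOpposite.op (-(y * l)))) =
      ((-1) ^ (n + 1) * (-1) ^ n * (a ^ (n.choose 2) * b ^ n)) •
        (serre n c x y * (k ^ n * l)) := by
    rw [serre, ← Finset.sum_range_reflect, serre, Finset.sum_mul, Finset.smul_sum]
    change (MulOpposite.opAddEquiv.symm : Cᵐᵒᵖ ≃+ C) _ = _
    rw [map_sum]
    refine Finset.sum_congr rfl fun r hr => ?_
    have hr' : r ≤ n := Nat.lt_succ_iff.mp (Finset.mem_range.mp hr)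
    have e1 : n + 1 - 1 - r = n - r := by omega
    have e2 : n - (n - r) = r := by omega
    rw [e1, e2, qbinom_symm c hr']
    simp only [MulOpposite.opAddEquiv_symm_apply, MulOpposite.unop_smul, MulOpposite.unop_mul, MulOpposite.unop_pow,
      MulOpposite.unop_op]
    rw [neg_pow (x * k) (n - r), neg_pow (x * k) r]
    have hw := twist_word hx hy hl hkl (n - r) r
    rw [Nat.sub_add_cancel hr'] at hw
    have e3 : (-1 : C) ^ (n - r) * (x * k) ^ (n - r) * (-(y * l) * ((-1) ^ r * (x * k) ^ r)) =
        (-1 : Kh) ^ (n + 1) • ((x * k) ^ (n - r) * (y * l) * (x * k) ^ r) := by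
      have : (-1 : Kh) ^ (n + 1) = (-1) ^ (n - r) * (-1) * (-1) ^ r := by
        rw [← pow_succ, ← pow_add]; congr 1; omega
      rw [this]
      have hs : ∀ m, (-1 : C) ^ m = (-1 : Kh) ^ m • 1 := by
        intro m; induction m with
        | zero => simp
        | succ m ih => rw [pow_succ, pow_succ, ih]; simp
      rw [hs, hs]
      simp only [smul_mul_assoc, mul_smul_comm, smul_smul, one_mul, neg_mul, mul_neg, smul_neg,
        neg_smul, mul_one, mul_assoc]
      congr 2; ring
    rw [e3, hw, smul_smul, smul_smul, smul_mul_assoc, smul_smul]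
    congr 1
    have : (-1 : Kh) ^ (n - r) = (-1) ^ n * (-1) ^ r := by
      rw [← pow_add]
      rw [show n + r = (n - r) + 2 * r by omega, pow_add, pow_mul]; simp
    rw [this]; ring
  rw [e, h]; simp

end series

/-- A Cartan matrix of finite type (the Cartan matrix of a complex semisimple Lie algebra)
together with a choice of the numbers `d i = (α_i, α_i) / 2`. -/
structure CartanDatum (ι : Type*) [Fintype ι] where
  A : Matrix ι ι ℤ
  d : ι → ℚ
  diag : ∀ i, A i i = 2
  nonpos : ∀ i j, i ≠ j → A i j ≤ 0
  d_pos : ∀ i, 0 < d i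
  symm : ∀ i j, d i * A i j = d j * A j i
  posDef : ∀ x : ι → ℚ, x ≠ 0 → 0 < ∑ i, ∑ j, x i * (d i * A i j) * x j

/-- A family of would-be Chevalley generators `H i`, `E i`, `F i` in `C`. -/
structure Gens (ι : Type*) (C : Type*) where
  H : ι → C
  E : ι → C
  F : ι → C

/-- The image of a family of generators under a map. -/
def Gens.map {ι C C' : Type*} (f : C → C') (t : Gens ι C) : Gens ι C' :=
  ⟨fun i => f (t.H i), fun i => f (t.E i), fun i => f (t.F i)⟩

/-- The names of the generators. -/
inductive GenName (ι : Type*)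
  | H (i : ι)
  | E (i : ι)
  | F (i : ι)

section level

variable {ι : Type*} [Fintype ι]
variable {C C' : Type*} [Ring C] [Algebra Kh C] [Ring C'] [Algebra Kh C']

/-- The defining relations of the Drinfeld–Jimbo algebra `U_h`, modulo `h ^ N`. -/
inductive Rel (D : CartanDatum ι) (N : ℕ) (t : Gens ι C) : C → C → Prop
  | HH (i j : ι) : Rel D N t (t.H i * t.H j - t.H j * t.H i) 0
  | HE (i j : ι) : Rel D N t (t.H i * t.E j - t.E j * t.H i) (D.A i j • t.E j)
  | HF (i j : ι) : Rel D N t (t.H i * t.F j - t.F j * t.H i) (-(D.A i j) • t.F j)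
  | EF (i : ι) : Rel D N t (t.E i * t.F i - t.F i * t.E i) (hquot N (D.d i) (t.H i))
  | EF_ne (i j : ι) : i ≠ j → Rel D N t (t.E i * t.F j - t.F j * t.E i) 0
  | serreE (i j : ι) : i ≠ j →
      Rel D N t (serre (1 - D.A i j).toNat (D.d i) (t.E i) (t.E j)) 0
  | serreF (i j : ι) : i ≠ j →
      Rel D N t (serre (1 - D.A i j).toNat (D.d i) (t.F i) (t.F j)) 0
  | hpow : Rel D N t (algebraMap Kh C (PowerSeries.X ^ N)) 0

/-- The family `t` satisfies the relations of `U_h` modulo `h ^ N`. -/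
def Sat (D : CartanDatum ι) (N : ℕ) (t : Gens ι C) : Prop := ∀ a b, Rel D N t a b → a = b

/-- The generators of the free `ℂ[[h]]`-algebra. -/
def freeGens (ι : Type*) : Gens ι (FreeAlgebra Kh (GenName ι)) :=
  ⟨fun i => FreeAlgebra.ι Kh (GenName.H i), fun i => FreeAlgebra.ι Kh (GenName.E i),
    fun i => FreeAlgebra.ι Kh (GenName.F i)⟩

/-- `U_h / h ^ N U_h`: the `ℂ[[h]]`-algebra with generators `H i`, `E i`, `F i`, the relations of
the Drinfeld–Jimbo algebra, and `h ^ N = 0`. The exponential series are finite sums here. -/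
def UhLevel (D : CartanDatum ι) (N : ℕ) : Type _ := RingQuot (Rel D N (freeGens ι))

instance (D : CartanDatum ι) (N : ℕ) : Ring (UhLevel D N) :=
  inferInstanceAs (Ring (RingQuot (Rel D N (freeGens ι))))

instance (D : CartanDatum ι) (N : ℕ) : Algebra Kh (UhLevel D N) :=
  inferInstanceAs (Algebra Kh (RingQuot (Rel D N (freeGens ι))))

namespace UhLevel

/-- The projection of the free algebra. -/
def mk (D : CartanDatum ι) (N : ℕ) : FreeAlgebra Kh (GenName ι) →ₐ[Kh] UhLevel D N :=
  RingQuot.mkAlgHom Kh (Rel D N (freeGens ι))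

theorem mk_surjective (D : CartanDatum ι) (N : ℕ) : Function.Surjective (mk D N) :=
  RingQuot.mkAlgHom_surjective Kh _

/-- The generators of `U_h / h ^ N U_h`. -/
def gens (D : CartanDatum ι) (N : ℕ) : Gens ι (UhLevel D N) := (freeGens ι).map (mk D N)

end UhLevel

theorem Rel.map {D : CartanDatum ι} {N : ℕ} {t : Gens ι C} (f : C →ₐ[Kh] C') {a b : C}
    (h : Rel D N t a b) : Rel D N (t.map f) (f a) (f b) := by
  cases h with
  | HH i j => simpa [Gens.map] using Rel.HH (D := D) (N := N) (t := t.map f) i j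
  | HE i j => simpa [Gens.map] using Rel.HE (D := D) (N := N) (t := t.map f) i j
  | HF i j => simpa [Gens.map] using Rel.HF (D := D) (N := N) (t := t.map f) i j
  | EF i => simpa [Gens.map, map_hquot] using Rel.EF (D := D) (N := N) (t := t.map f) i
  | EF_ne i j h => simpa [Gens.map] using Rel.EF_ne (D := D) (N := N) (t := t.map f) i j h
  | serreE i j h =>
    simpa [Gens.map, map_serre] using Rel.serreE (D := D) (N := N) (t := t.map f) i j h
  | serreF i j h =>
    simpa [Gens.map, map_serre] using Rel.serreF (D := D) (N := N) (t := t.map f) i j h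
  | hpow => simpa [Gens.map] using Rel.hpow (D := D) (N := N) (t := t.map f)

theorem Rel.of_map {D : CartanDatum ι} {N : ℕ} {t : Gens ι C} {f : C →ₐ[Kh] C'} {a b : C'}
    (h : Rel D N (t.map f) a b) : ∃ a' b', f a' = a ∧ f b' = b ∧ Rel D N t a' b' := by
  cases h with
  | HH i j => exact ⟨_, _, by simp [Gens.map], by simp, Rel.HH i j⟩
  | HE i j => exact ⟨_, _, by simp [Gens.map], by simp [Gens.map], Rel.HE i j⟩
  | HF i j => exact ⟨_, _, by simp [Gens.map], by simp [Gens.map], Rel.HF i j⟩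
  | EF i => exact ⟨_, _, by simp [Gens.map], by simp [Gens.map, map_hquot], Rel.EF i⟩
  | EF_ne i j h => exact ⟨_, _, by simp [Gens.map], by simp, Rel.EF_ne i j h⟩
  | serreE i j h => exact ⟨_, _, by simp [Gens.map, map_serre], by simp, Rel.serreE i j h⟩
  | serreF i j h => exact ⟨_, _, by simp [Gens.map, map_serre], by simp, Rel.serreF i j h⟩
  | hpow => exact ⟨_, _, by simp, by simp, Rel.hpow⟩

/-- The homomorphism out of the free algebra given by a family of elements. -/
def freeLift (t : Gens ι C) : FreeAlgebra Kh (GenName ι) →ₐ[Kh] C :=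
  FreeAlgebra.lift Kh fun g => match g with
    | .H i => t.H i
    | .E i => t.E i
    | .F i => t.F i

theorem map_freeLift (t : Gens ι C) : (freeGens ι).map (freeLift t) = t := by
  cases t; simp [Gens.map, freeGens, freeLift]

namespace UhLevel

/-- The universal property of `U_h / h ^ N U_h`. -/
def lift {D : CartanDatum ι} {N : ℕ} (t : Gens ι C) (ht : Sat D N t) : UhLevel D N →ₐ[Kh] C :=
  RingQuot.liftAlgHom Kh ⟨freeLift t, fun a b h => ht _ _ (by
    simpa only [map_freeLift] using h.map (freeLift t))⟩

@[simp]
theorem lift_mk {D : CartanDatum ι} {N : ℕ} (t : Gens ι C) (ht : Sat D N t)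
    (a : FreeAlgebra Kh (GenName ι)) : lift t ht (mk D N a) = freeLift t a :=
  RingQuot.liftAlgHom_mkAlgHom_apply _ _ _ _

theorem map_lift {D : CartanDatum ι} {N : ℕ} (t : Gens ι C) (ht : Sat D N t) :
    (gens D N).map (lift t ht) = t := by
  conv_rhs => rw [← map_freeLift t]
  simp [gens, Gens.map]

theorem hom_ext {D : CartanDatum ι} {N : ℕ} {f g : UhLevel D N →ₐ[Kh] C}
    (h : (gens D N).map f = (gens D N).map g) : f = g := by
  have : f.comp (mk D N) = g.comp (mk D N) := by
    refine FreeAlgebra.hom_ext (funext fun x => ?_)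
    simp only [gens, Gens.map, freeGens, Gens.mk.injEq, funext_iff] at h
    cases x with
    | H i => exact h.1 i
    | E i => exact h.2.1 i
    | F i => exact h.2.2 i
  ext x
  obtain ⟨a, rfl⟩ := mk_surjective D N x
  exact DFunLike.congr_fun this a

theorem sat_gens (D : CartanDatum ι) (N : ℕ) : Sat D N (gens D N) := by
  intro a b h
  obtain ⟨a', b', rfl, rfl, h'⟩ := h.of_map
  exact RingQuot.mkAlgHom_rel Kh h'

end UhLevel
end level

section
variable {ι : Type*} [Fintype ι]
variable {C C' : Type*} [Ring C] [Algebra Kh C] [Ring C'] [Algebra Kh C']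
variable {D : CartanDatum ι} {N : ℕ} {t : Gens ι C}

theorem Sat.hN (h : Sat D N t) : algebraMap Kh C (PowerSeries.X ^ N) = 0 := h _ _ Rel.hpow

theorem Sat.map (h : Sat D N t) (f : C →ₐ[Kh] C') : Sat D N (t.map f) := by
  intro a b hab
  obtain ⟨a', b', rfl, rfl, h'⟩ := hab.of_map
  rw [h _ _ h']

theorem Sat.succ (h : Sat D N t) : Sat D (N + 1) t := by
  intro a b hab
  cases hab with
  | HH i j => exact h _ _ (Rel.HH i j)
  | HE i j => exact h _ _ (Rel.HE i j)
  | HF i j => exact h _ _ (Rel.HF i j)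
  | EF i => rw [hquot_succ h.hN]; exact h _ _ (Rel.EF i)
  | EF_ne i j hij => exact h _ _ (Rel.EF_ne i j hij)
  | serreE i j hij => exact h _ _ (Rel.serreE i j hij)
  | serreF i j hij => exact h _ _ (Rel.serreF i j hij)
  | hpow => rw [pow_succ, map_mul, h.hN, zero_mul]

/-- The images of the generators under the antipode of `U_h`, with values in the opposite
algebra: `S(H_i) = -H_i`, `S(E_i) = -E_i K_i⁻¹`, `S(F_i) = -K_i F_i` for `K_i = e^{d_i h H_i}`. -/
def Gens.anti (D : CartanDatum ι) (N : ℕ) (t : Gens ι C) : Gens ι Cᵐᵒᵖ where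
  H i := MulOpposite.op (-t.H i)
  E i := MulOpposite.op (-(t.E i * hexp N (-D.d i) (t.H i)))
  F i := MulOpposite.op (-(hexp N (D.d i) (t.H i) * t.F i))

theorem Sat.anti (h : Sat D N t) : Sat D N (t.anti D N) := by
  have hN := h.hN
  have HH : ∀ i j, Commute (t.H i) (t.H j) := fun i j => sub_eq_zero.mp (h _ _ (Rel.HH i j))
  have KE : ∀ c i j, hexp N c (t.H i) * t.E j =
      qpow (c * D.A i j) • (t.E j * hexp N c (t.H i)) :=
    fun c i j => hexp_semiconj hN c _ (h _ _ (Rel.HE i j))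
  have KF : ∀ c i j, hexp N c (t.H i) * t.F j =
      qpow (-(c * D.A i j)) • (t.F j * hexp N c (t.H i)) := by
    intro c i j
    rw [hexp_semiconj hN c _ (h _ _ (Rel.HF i j))]
    congr 2; push_cast; ring
  have KK : ∀ c c' i j, Commute (hexp N c (t.H i)) (hexp N c' (t.H j)) := fun c c' i j =>
    commute_hexp _ (commute_hexp _ (HH j i)).symm
  have sym : ∀ i j, D.d i * D.A i j = D.d j * D.A j i := D.symm
  intro a b hab
  cases hab with
  | HH i j =>
    simp only [Gens.anti, ← MulOpposite.op_mul, ← MulOpposite.op_sub, MulOpposite.op_eq_zero_iff]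
    simp [(HH i j).eq]
  | HE i j =>
    simp only [Gens.anti, ← MulOpposite.op_mul, ← MulOpposite.op_sub, ← MulOpposite.op_smul]
    congr 1
    have h1 := h _ _ (Rel.HE i j)
    have h2 := (commute_hexp (N := N) (-D.d j) (HH j i)).eq
    simp only [neg_mul, mul_neg, neg_neg, smul_neg]
    rw [← smul_mul_assoc, ← h1, sub_mul, mul_assoc, h2, ← mul_assoc, ← mul_assoc]; abel
  | HF i j =>
    simp only [Gens.anti, ← MulOpposite.op_mul, ← MulOpposite.op_sub, ← MulOpposite.op_smul]
    congr 1
    have h1 := h _ _ (Rel.HF i j)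
    have h2 := (commute_hexp (N := N) (D.d j) (HH j i)).eq
    simp only [neg_mul, mul_neg, neg_neg, smul_neg]
    rw [← mul_smul_comm, ← h1, mul_sub, ← mul_assoc, ← mul_assoc, h2]; simp only [mul_assoc]; abel
  | EF i =>
    have h1 := h _ _ (Rel.EF i)
    simp only [Gens.anti, ← MulOpposite.op_mul, ← MulOpposite.op_sub]
    have h3 : hquot N (D.d i) (MulOpposite.op (-t.H i)) =
        MulOpposite.op (hquot N (D.d i) (-t.H i)) := by
      simp only [hquot, MulOpposite.op_smul, ← MulOpposite.op_pow]
      congr 1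
      change _ = (MulOpposite.opAddEquiv : C ≃+ Cᵐᵒᵖ) _
      rw [map_sum]
      rfl
    rw [h3, hquot_neg]
    congr 1
    rw [← h1]
    have e1 : hexp N (D.d i) (t.H i) * t.F i * (t.E i * hexp N (-D.d i) (t.H i)) =
        t.F i * t.E i := by
      rw [KF, smul_mul_assoc, mul_assoc, ← mul_assoc _ (t.E i), KE, smul_mul_assoc, mul_smul_comm,
        smul_smul, mul_assoc, hexp_mul_neg hN, ← qpow_add, mul_one, neg_add_cancel, qpow_zero,
        one_smul]
    have e2 : t.E i * hexp N (-D.d i) (t.H i) * (hexp N (D.d i) (t.H i) * t.F i) =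
        t.E i * t.F i := by
      rw [mul_assoc, ← mul_assoc _ _ (t.F i), hexp_neg_mul hN, one_mul]
    simp only [neg_mul, mul_neg, neg_neg]
    rw [e1, e2]; abel
  | EF_ne i j hij =>
    have h1 := sub_eq_zero.mp (h _ _ (Rel.EF_ne i j hij))
    simp only [Gens.anti, ← MulOpposite.op_mul, ← MulOpposite.op_sub, MulOpposite.op_eq_zero_iff]
    simp only [neg_mul, mul_neg, neg_neg]
    rw [sub_eq_zero]
    calc hexp N (D.d j) (t.H j) * t.F j * (t.E i * hexp N (-D.d i) (t.H i))
        = (hexp N (D.d j) (t.H j) * t.E i) * (t.F j * hexp N (-D.d i) (t.H i)) := by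
          simp only [mul_assoc]; rw [← mul_assoc (t.F j), ← h1]; simp only [mul_assoc]
      _ = qpow (D.d j * D.A j i) •
            (t.E i * (hexp N (D.d j) (t.H j) * (t.F j * hexp N (-D.d i) (t.H i)))) := by
          rw [KE]; simp only [smul_mul_assoc, mul_assoc]
      _ = t.E i * hexp N (-D.d i) (t.H i) * (hexp N (D.d j) (t.H j) * t.F j) := by
          rw [mul_assoc, ← mul_assoc _ _ (t.F j), (KK _ _ i j).eq, mul_assoc, KF, neg_mul, neg_neg,
            sym]
          simp only [mul_smul_comm]
  | serreE i j hij =>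
    refine serre_twist _ _ (KE _ i i) (KE _ i j) ?_ (KK _ _ _ _) (h _ _ (Rel.serreE i j hij))
    rw [KE, neg_mul, neg_mul, sym]
  | serreF i j hij =>
    have e : ∀ i, (t.anti D N).F i = qpow (-(D.d i * D.A i i)) •
        MulOpposite.op (-(t.F i * hexp N (D.d i) (t.H i))) := by
      intro i
      simp only [Gens.anti, KF, ← smul_neg, MulOpposite.op_smul]
    rw [e, e, serre_smul, serre_twist _ _ (KF _ i i) (KF _ i j) (by rw [KF, sym]) (KK _ _ i j)
      (h _ _ (Rel.serreF i j hij)), smul_zero]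
  | hpow =>
    rw [MulOpposite.algebraMap_apply, hN]; rfl
end

/-- The inverse limit `lim_N A N` of `ℂ[[h]]`-algebras. With `A N = U / h ^ N U` it is the
`h`-adic completion of `U`. -/
def invLim (A : ℕ → Type*) [∀ N, Ring (A N)] [∀ N, Algebra Kh (A N)]
    (tr : ∀ N, A (N + 1) →ₐ[Kh] A N) : Subalgebra Kh (∀ N, A N) where
  carrier := {x | ∀ N, tr N (x (N + 1)) = x N}
  mul_mem' hx hy N := by simp [hx N, hy N]
  add_mem' hx hy N := by simp [hx N, hy N]
  algebraMap_mem' r N := by simp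

/-- The tensor product of algebra homomorphisms over a family of algebras. -/
def piTensorMap {κ : Type*} {A B : κ → Type*} [∀ i, Ring (A i)] [∀ i, Algebra Kh (A i)]
    [∀ i, Ring (B i)] [∀ i, Algebra Kh (B i)] (f : ∀ i, A i →ₐ[Kh] B i) :
    (⨂[Kh] i, A i) →ₐ[Kh] ⨂[Kh] i, B i :=
  PiTensorProduct.liftAlgHom
    ((PiTensorProduct.tprod Kh).compLinearMap fun i => (f i).toLinearMap)
    (by simp only [MultilinearMap.compLinearMap_apply]
        rw [PiTensorProduct.one_def]; congr 1; ext i; simp)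
    (fun x y => by
      simp only [MultilinearMap.compLinearMap_apply]
      rw [PiTensorProduct.tprod_mul_tprod]; congr 1; ext i; simp)

@[simp]
theorem piTensorMap_tprod {κ : Type*} {A B : κ → Type*} [∀ i, Ring (A i)] [∀ i, Algebra Kh (A i)]
    [∀ i, Ring (B i)] [∀ i, Algebra Kh (B i)] (f : ∀ i, A i →ₐ[Kh] B i) (x : ∀ i, A i) :
    piTensorMap f (PiTensorProduct.tprod Kh x) = PiTensorProduct.tprod Kh fun i => f i (x i) := by
  simp [piTensorMap]

section
variable {ι : Type*} [Fintype ι]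

namespace UhLevel

/-- The projection `U_h / h ^ (N + 1) → U_h / h ^ N`. -/
def trans (D : CartanDatum ι) (N : ℕ) : UhLevel D (N + 1) →ₐ[Kh] UhLevel D N :=
  lift (gens D N) (sat_gens D N).succ

@[simp]
theorem trans_mk (D : CartanDatum ι) (N : ℕ) (a : FreeAlgebra Kh (GenName ι)) :
    trans D N (mk D (N + 1) a) = mk D N a := by
  have : (trans D N).comp (mk D (N + 1)) = mk D N := by
    refine FreeAlgebra.hom_ext (funext fun x => ?_)
    cases x <;> simp [trans, freeLift, gens, freeGens, Gens.map]
  exact DFunLike.congr_fun this a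

theorem gens_map_trans (D : CartanDatum ι) (N : ℕ) :
    (gens D (N + 1)).map (trans D N) = gens D N := map_lift _ _

theorem trans_surjective (D : CartanDatum ι) (N : ℕ) : Function.Surjective (trans D N) := by
  intro x
  obtain ⟨a, rfl⟩ := mk_surjective D N x
  exact ⟨_, trans_mk D N a⟩

/-- The kernel of `U_h / h ^ (N + 1) → U_h / h ^ N` is generated by `h ^ N`. -/
theorem ker_trans (D : CartanDatum ι) (N : ℕ) (x : UhLevel D (N + 1)) (hx : trans D N x = 0) :
    ∃ a, x = (PowerSeries.X ^ N : Kh) • mk D (N + 1) a := by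
  let I : Ideal (UhLevel D (N + 1)) := Ideal.span {algebraMap Kh _ (PowerSeries.X ^ N)}
  have mem : ∀ y, y ∈ I ↔ ∃ z, z * algebraMap Kh _ (PowerSeries.X ^ N) = y := fun y =>
    Ideal.mem_span_singleton'
  have : I.IsTwoSided := ⟨fun b h => by
    obtain ⟨z, rfl⟩ := (mem _).1 h
    exact (mem _).2 ⟨z * b, by rw [mul_assoc, mul_assoc, Algebra.commutes]⟩⟩
  let π : UhLevel D (N + 1) →ₐ[Kh] UhLevel D (N + 1) ⧸ I := Ideal.Quotient.mkₐ Kh I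
  have hN : algebraMap Kh (UhLevel D (N + 1) ⧸ I) (PowerSeries.X ^ N) = 0 := by
    rw [← π.commutes]
    exact Ideal.Quotient.eq_zero_iff_mem.2 (Ideal.mem_span_singleton_self _)
  have hs : Sat D N ((gens D (N + 1)).map π) := by
    have h1 := (sat_gens D (N + 1)).map π
    intro a b hab
    cases hab with
    | HH i j => exact h1 _ _ (Rel.HH i j)
    | HE i j => exact h1 _ _ (Rel.HE i j)
    | HF i j => exact h1 _ _ (Rel.HF i j)
    | EF i => rw [← hquot_succ hN]; exact h1 _ _ (Rel.EF i)
    | EF_ne i j hij => exact h1 _ _ (Rel.EF_ne i j hij)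
    | serreE i j hij => exact h1 _ _ (Rel.serreE i j hij)
    | serreF i j hij => exact h1 _ _ (Rel.serreF i j hij)
    | hpow => exact hN
  have e : (lift _ hs).comp (trans D N) = π := by
    refine hom_ext ?_
    exact (congrArg (Gens.map (lift _ hs)) (gens_map_trans D N)).trans (map_lift _ hs)
  have : π x = 0 := by rw [← e, AlgHom.comp_apply, hx, map_zero]
  obtain ⟨z, hz⟩ := (mem _).1 (Ideal.Quotient.eq_zero_iff_mem.1 this)
  obtain ⟨a, rfl⟩ := mk_surjective D _ z
  exact ⟨a, by rw [← hz, Algebra.smul_def, Algebra.commutes]⟩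

end UhLevel

/-- The Drinfeld–Jimbo algebra `U_h(g)` over `ℂ[[h]]`, as the inverse limit of its quotients
`U_h(g) / h ^ N U_h(g)`. -/
abbrev Uh (D : CartanDatum ι) : Type _ := invLim (UhLevel D) (UhLevel.trans D)

namespace Uh

/-- The projection `U_h → U_h / h ^ N`. -/
def ev (D : CartanDatum ι) (N : ℕ) : Uh D →ₐ[Kh] UhLevel D N :=
  (Pi.evalAlgHom Kh (UhLevel D) N).comp (invLim (UhLevel D) (UhLevel.trans D)).val

theorem trans_ev (D : CartanDatum ι) (N : ℕ) (x : Uh D) :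
    UhLevel.trans D N (ev D (N + 1) x) = ev D N x := x.2 N

theorem ext' {D : CartanDatum ι} {x y : Uh D} (h : ∀ N, ev D N x = ev D N y) : x = y :=
  Subtype.ext (funext h)

/-- The homomorphism from the free algebra to `U_h`. -/
def mk (D : CartanDatum ι) : FreeAlgebra Kh (GenName ι) →ₐ[Kh] Uh D where
  toFun a := ⟨fun N => UhLevel.mk D N a, fun N => UhLevel.trans_mk D N a⟩
  map_one' := Subtype.ext (funext fun _ => map_one _)
  map_mul' a b := Subtype.ext (funext fun _ => map_mul _ a b)
  map_zero' := Subtype.ext (funext fun _ => map_zero _)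
  map_add' a b := Subtype.ext (funext fun _ => map_add _ a b)
  commutes' r := Subtype.ext (funext fun N => (UhLevel.mk D N).commutes r)

@[simp]
theorem ev_mk (D : CartanDatum ι) (N : ℕ) (a : FreeAlgebra Kh (GenName ι)) :
    ev D N (mk D a) = UhLevel.mk D N a := rfl

/-- The generators `H_i`, `E_i`, `F_i` of `U_h`. -/
def gens (D : CartanDatum ι) : Gens ι (Uh D) := (freeGens ι).map (mk D)

theorem ev_surjective (D : CartanDatum ι) (N : ℕ) : Function.Surjective (ev D N) := by
  intro x
  obtain ⟨a, rfl⟩ := UhLevel.mk_surjective D N x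
  exact ⟨mk D a, rfl⟩

theorem ev_eq_zero_of_le {D : CartanDatum ι} {M N : ℕ} (h : M ≤ N) {x : Uh D}
    (hx : ev D N x = 0) : ev D M x = 0 := by
  induction N, h using Nat.le_induction with
  | base => exact hx
  | succ N _ ih => exact ih (by rw [← trans_ev, hx, map_zero])

/-- The kernel of `U_h → U_h / h ^ N` is `h ^ N U_h`. -/
theorem ker_ev (D : CartanDatum ι) (N : ℕ) (x : Uh D) (hx : ev D N x = 0) :
    ∃ y, x = (PowerSeries.X ^ N : Kh) • y := by
  have step : ∀ k (s : FreeAlgebra Kh (GenName ι)),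
      ev D (N + k) (x - (PowerSeries.X ^ N : Kh) • mk D s) = 0 →
      ∃ a, ev D (N + (k + 1)) (x - (PowerSeries.X ^ N : Kh) •
        mk D (s + (PowerSeries.X ^ k : Kh) • a)) = 0 := by
    intro k s hs
    obtain ⟨a, ha⟩ := UhLevel.ker_trans D (N + k) 
      (ev D (N + k + 1) (x - (PowerSeries.X ^ N : Kh) • mk D s))
      (by rw [trans_ev, hs])
    refine ⟨a, ?_⟩
    have e : ev D (N + k + 1) ((PowerSeries.X ^ N : Kh) • mk D ((PowerSeries.X ^ k : Kh) • a)) =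
        (PowerSeries.X ^ (N + k) : Kh) • UhLevel.mk D (N + k + 1) a := by
      rw [map_smul, ev_mk, map_smul, smul_smul, ← pow_add]
    rw [map_add, smul_add, ← sub_sub, map_sub, ← add_assoc, ha, e, sub_self]
  choose! a ha using step
  let s : ℕ → FreeAlgebra Kh (GenName ι) := fun k =>
    Nat.rec 0 (fun k s => s + (PowerSeries.X ^ k : Kh) • a k s) k
  have hs : ∀ k, ev D (N + k) (x - (PowerSeries.X ^ N : Kh) • mk D (s k)) = 0 := by
    intro k
    induction k with
    | zero => simpa [s] using hx
    | succ k ih => exact ha k (s k) ih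
  refine ⟨⟨fun M => UhLevel.mk D M (s M), fun M => ?_⟩, ext' fun M => ?_⟩
  · have e : s (M + 1) = s M + (PowerSeries.X ^ M : Kh) • a M (s M) := rfl
    rw [UhLevel.trans_mk, e, map_add, map_smul, hpow_smul (UhLevel.sat_gens D M).hN, add_zero]
  · have := ev_eq_zero_of_le (Nat.le_add_left M N) (hs M)
    rw [map_sub, sub_eq_zero] at this
    rw [this]; rfl

/-- The antipode of `U_h` modulo `h ^ N`, as a homomorphism to the opposite algebra. -/
def antipodeLevel (D : CartanDatum ι) (N : ℕ) : UhLevel D N →ₐ[Kh] (UhLevel D N)ᵐᵒᵖ :=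
  UhLevel.lift _ (UhLevel.sat_gens D N).anti

theorem trans_antipodeLevel (D : CartanDatum ι) (N : ℕ) (x : UhLevel D (N + 1)) :
    UhLevel.trans D N (antipodeLevel D (N + 1) x).unop =
      (antipodeLevel D N (UhLevel.trans D N x)).unop := by
  have hN := (UhLevel.sat_gens D N).hN
  have : (UhLevel.trans D N).op.comp (antipodeLevel D (N + 1)) =
      (antipodeLevel D N).comp (UhLevel.trans D N) := by
    refine UhLevel.hom_ext ?_
    have h1 := UhLevel.map_lift _ (UhLevel.sat_gens D (N + 1)).anti
    have h2 := UhLevel.map_lift _ (UhLevel.sat_gens D N).anti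
    have h3 := UhLevel.gens_map_trans D N
    have h4 : (UhLevel.gens D (N + 1)).map ((UhLevel.trans D N).op.comp (antipodeLevel D (N + 1))) =
        ((UhLevel.gens D (N + 1)).anti D (N + 1)).map (UhLevel.trans D N).op := by
      rw [← h1]; rfl
    have h5 : (UhLevel.gens D (N + 1)).map ((antipodeLevel D N).comp (UhLevel.trans D N)) =
        (UhLevel.gens D N).anti D N := by
      exact (congrArg (Gens.map (antipodeLevel D N)) h3).trans h2
    rw [h4, h5, ← h3]
    simp only [Gens.map, Gens.anti, Gens.mk.injEq, funext_iff]
    refine ⟨fun i => ?_, fun i => ?_, fun i => ?_⟩ <;>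
      simp [map_hexp, hexp_succ hN]
  exact congrArg MulOpposite.unop (DFunLike.congr_fun this x)

/-- The antipode of `U_h`: the anti-homomorphism with `S(H_i) = -H_i`, `S(E_i) = -E_i K_i⁻¹`,
`S(F_i) = -K_i F_i`, where `K_i = e^{d_i h H_i}`. -/
def antipode (D : CartanDatum ι) : Uh D →ₗ[Kh] Uh D where
  toFun x := ⟨fun N => (antipodeLevel D N (ev D N x)).unop, fun N => by
    rw [trans_antipodeLevel, trans_ev]⟩
  map_add' x y := Subtype.ext (funext fun N => by simp)
  map_smul' r x := Subtype.ext (funext fun N => by simp)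

end Uh
end

section
variable {ι : Type*} [Fintype ι] [DecidableEq ι]
variable {C C' : Type*} [Ring C] [Algebra Kh C] [Ring C'] [Algebra Kh C']

/-- Reflection `s_i` of the root lattice, in the coordinates given by the simple roots. -/
def CartanDatum.reflect (D : CartanDatum ι) (i : ι) (v : ι → ℤ) : ι → ℤ :=
  v - Pi.single i (∑ j, D.A i j * v j)

/-- The roots: the orbits of the simple roots under the Weyl group. -/
inductive CartanDatum.IsRoot (D : CartanDatum ι) : (ι → ℤ) → Prop
  | simple (i : ι) : IsRoot D (Pi.single i 1)
  | reflect (i : ι) (v : ι → ℤ) : IsRoot D v → IsRoot D (D.reflect i v)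

/-- For a word `i_1, …, i_l` the sequence of roots `β_r = s_{i_1} ⋯ s_{i_{r-1}} (α_{i_r})`. -/
def CartanDatum.rootSeq (D : CartanDatum ι) : List ι → List (ι → ℤ)
  | [] => []
  | i :: w => Pi.single i 1 :: (D.rootSeq w).map (D.reflect i)

/-- The word is a reduced expression of the longest element of the Weyl group, that is, the
sequence `β_1, …, β_l` runs through all positive roots, without repetition. -/
def CartanDatum.IsLongest (D : CartanDatum ι) (w : List ι) : Prop :=
  (D.rootSeq w).Nodup ∧ ∀ v, v ∈ D.rootSeq w ↔ D.IsRoot v ∧ ∀ j, 0 ≤ v j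

/-- The inverse `B` of the matrix `(2 a_{ij} / (α_j, α_j)) = (a_{ij} / d_j)`. -/
def CartanDatum.B (D : CartanDatum ι) : Matrix ι ι ℚ :=
  (Matrix.of fun i j => (D.A i j : ℚ) / D.d j)⁻¹

/-- Lusztig's automorphism `T_i`: the images of the generators `H_j`, `E_j`, `F_j`, computed from a
given family of generators. With `K_i = e^{d_i h H_i}`, `q_i = e^{d_i h}` and divided powers
`x^{(r)} = x^r / [r]!`, these are `T_i H_j = H_j - a_{ji} H_i`, `T_i E_i = - F_i K_i`,
`T_i F_i = - K_i⁻¹ E_i` and, for `j ≠ i`,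
`T_i E_j = ∑_r (-1)^{r - a_{ij}} q_i^{-r} E_i^{(-a_{ij}-r)} E_j E_i^{(r)}`,
`T_i F_j = ∑_r (-1)^{r - a_{ij}} q_i^r F_i^{(r)} F_j F_i^{(-a_{ij}-r)}`. -/
def Gens.braid (D : CartanDatum ι) (N : ℕ) (i : ι) (t : Gens ι C) : Gens ι C where
  H j := t.H j - D.A j i • t.H i
  E j := if j = i then -(t.F i * hexp N (D.d i) (t.H i)) else
    ∑ r ∈ Finset.range ((-D.A i j).toNat + 1),
      ((-1) ^ (r + (-D.A i j).toNat) * qpow (-(D.d i * r)) *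
        (qfact (D.d i) ((-D.A i j).toNat - r))⁻¹ * (qfact (D.d i) r)⁻¹ : Kh) •
          (t.E i ^ ((-D.A i j).toNat - r) * t.E j * t.E i ^ r)
  F j := if j = i then -(hexp N (-D.d i) (t.H i) * t.E i) else
    ∑ r ∈ Finset.range ((-D.A i j).toNat + 1),
      ((-1) ^ (r + (-D.A i j).toNat) * qpow (D.d i * r) *
        (qfact (D.d i) ((-D.A i j).toNat - r))⁻¹ * (qfact (D.d i) r)⁻¹ : Kh) •
          (t.F i ^ r * t.F j * t.F i ^ ((-D.A i j).toNat - r))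

/-- For a word `i_1, …, i_l` the triples `(d_β, E_β, F_β)`, `β = β_1, …, β_l`, where
`d_β = (β, β) / 2` and `E_β = T_{i_1} ⋯ T_{i_{r-1}} (E_{i_r})`, `F_β = T_{i_1} ⋯ T_{i_{r-1}} (F_{i_r})`
for `β = β_r`. -/
def rootVectors (D : CartanDatum ι) (N : ℕ) : List ι → Gens ι C → List (ℚ × C × C)
  | [], _ => []
  | i :: w, t => (D.d i, t.E i, t.F i) :: rootVectors D N w (t.braid D N i)

theorem Gens.map_braid (D : CartanDatum ι) (N : ℕ) (i : ι) (t : Gens ι C) (f : C →ₐ[Kh] C') :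
    (t.braid D N i).map f = (t.map f).braid D N i := by
  simp only [Gens.map, Gens.braid, Gens.mk.injEq, funext_iff]
  refine ⟨fun j => by simp, fun j => ?_, fun j => ?_⟩ <;> split_ifs <;> simp [map_hexp]

theorem Gens.braid_succ (D : CartanDatum ι) {N : ℕ}
    (hN : algebraMap Kh C (PowerSeries.X ^ N) = 0) (i : ι) (t : Gens ι C) :
    t.braid D (N + 1) i = t.braid D N i := by
  simp only [Gens.braid, hexp_succ hN]

theorem map_rootVectors (D : CartanDatum ι) (N : ℕ) (w : List ι) (t : Gens ι C)
    (f : C →ₐ[Kh] C') :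
    (rootVectors D N w t).map (fun p => (p.1, f p.2.1, f p.2.2)) =
      rootVectors D N w (t.map f) := by
  induction w generalizing t with
  | nil => rfl
  | cons i w ih => simp only [rootVectors, List.map_cons, ih, Gens.map_braid]; rfl

theorem rootVectors_succ (D : CartanDatum ι) {N : ℕ}
    (hN : algebraMap Kh C (PowerSeries.X ^ N) = 0) (w : List ι) (t : Gens ι C) :
    rootVectors D (N + 1) w t = rootVectors D N w t := by
  induction w generalizing t with
  | nil => rfl
  | cons i w ih => simp only [rootVectors, ih, Gens.braid_succ D hN]

/-- The factor `exp_{q_β} ((1 - q_β⁻²) (E_β ⊗ F_β))` of the universal `R`-matrix. -/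
def rFactor (N : ℕ) (p : ℚ × C × C) : C ⊗[Kh] C :=
  qExp N p.1 ((1 - qpow (-2 * p.1)) • (p.2.1 ⊗ₜ[Kh] p.2.2))

/-- The universal `R`-matrix
`exp (h ∑_{i,j} B_{ij} H_i ⊗ H_j) ∏_β exp_{q_β} ((1 - q_β⁻²) (E_β ⊗ F_β))` modulo `h ^ N`, where `β`
runs through `β_1, …, β_l` from left to right. -/
def rLevel (D : CartanDatum ι) (w : List ι) (N : ℕ) (t : Gens ι C) : C ⊗[Kh] C :=
  hexp N 1 (∑ i, ∑ j, (algebraMap ℚ Kh (D.B i j)) • (t.H i ⊗ₜ[Kh] t.H j)) *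
    ((rootVectors D N w t).map (rFactor N)).prod

theorem map_rLevel (D : CartanDatum ι) (w : List ι) (N : ℕ) (t : Gens ι C) (f : C →ₐ[Kh] C') :
    Algebra.TensorProduct.map f f (rLevel D w N t) = rLevel D w N (t.map f) := by
  rw [rLevel, map_mul, map_hexp, map_list_prod, rLevel, ← map_rootVectors, List.map_map,
    List.map_map]
  congr 2
  · simp [Gens.map]
  · congr 1
    funext p
    simp [rFactor, map_qExp]

theorem tensor_hN {N : ℕ} (hN : algebraMap Kh C (PowerSeries.X ^ N) = 0) :
    algebraMap Kh (C ⊗[Kh] C) (PowerSeries.X ^ N) = 0 := by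
  rw [Algebra.TensorProduct.algebraMap_apply, hN, TensorProduct.zero_tmul]

theorem one_sub_qpow (c : ℚ) : ∃ g, 1 - qpow c = PowerSeries.X * g := by
  obtain ⟨g, hg⟩ := PowerSeries.X_dvd_iff.2 (show PowerSeries.constantCoeff (1 - qpow c) = 0 by
    simp [qpow, ← PowerSeries.coeff_zero_eq_constantCoeff])
  exact ⟨g, hg⟩

theorem qExp_succ {N : ℕ} (hN : algebraMap Kh C (PowerSeries.X ^ N) = 0) (c e : ℚ) (x : C) :
    qExp (N + 1) c ((1 - qpow e) • x) = qExp N c ((1 - qpow e) • x) := by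
  obtain ⟨g, hg⟩ := one_sub_qpow e
  have h0 : (PowerSeries.X ^ N * g ^ N : Kh) • x ^ N = 0 := by rw [mul_smul, hpow_smul hN]
  rw [qExp, Finset.sum_range_succ, hg, smul_pow _ x N, mul_pow, h0, smul_zero, add_zero, qExp]

theorem rLevel_succ (D : CartanDatum ι) (w : List ι) {N : ℕ}
    (hN : algebraMap Kh C (PowerSeries.X ^ N) = 0) (t : Gens ι C) :
    rLevel D w (N + 1) t = rLevel D w N t := by
  have h2 := tensor_hN hN
  rw [rLevel, hexp_succ h2, rootVectors_succ D hN, rLevel]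
  congr 3
  funext p
  rw [rFactor, qExp_succ h2, rFactor]

theorem isUnit_qExp {N : ℕ} (hN : algebraMap Kh C (PowerSeries.X ^ N) = 0) (c e : ℚ) (x : C) :
    IsUnit (qExp N c ((1 - qpow e) • x)) := by
  obtain ⟨g, hg⟩ := one_sub_qpow e
  cases N with
  | zero =>
    have h1 : (1 : C) = 0 := by simpa using hN
    have : Subsingleton C := subsingleton_of_zero_eq_one h1.symm
    exact isUnit_of_subsingleton _
  | succ N =>
    have : ∃ y : C, qExp (N + 1) c ((1 - qpow e) • x) = 1 + (PowerSeries.X : Kh) • y := by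
      rw [qExp, Finset.sum_range_succ', add_comm, hg]
      refine ⟨∑ r ∈ Finset.range N, (qpow (c * ((r + 1 : ℕ) * ((r + 1 : ℕ) + 1) / 2)) *
        (qfact c (r + 1))⁻¹ * g ^ (r + 1) * PowerSeries.X ^ r) • x ^ (r + 1), ?_⟩
      congr 1
      · simp [qfact, qpow_zero]
      · rw [Finset.smul_sum]
        refine Finset.sum_congr rfl fun r _ => ?_
        rw [smul_pow, smul_smul, smul_smul]
        congr 1; ring
    obtain ⟨y, hy⟩ := this
    rw [hy]
    refine IsNilpotent.isUnit_one_add ⟨N + 1, ?_⟩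
    rw [smul_pow, hpow_smul hN]

theorem isUnit_rLevel (D : CartanDatum ι) (w : List ι) {N : ℕ}
    (hN : algebraMap Kh C (PowerSeries.X ^ N) = 0) (t : Gens ι C) :
    IsUnit (rLevel D w N t) := by
  have h2 := tensor_hN hN
  refine IsUnit.mul ?_ ?_
  · exact ⟨⟨_, _, hexp_mul_neg h2 1 _, hexp_neg_mul h2 1 _⟩, rfl⟩
  · refine (IsUnit.submonoid (C ⊗[Kh] C)).list_prod_mem fun a ha => ?_
    obtain ⟨p, _, rfl⟩ := List.mem_map.1 ha
    exact isUnit_qExp h2 _ _ _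

namespace Uh

/-- The completed tensor square `U_h ⊗̂ U_h`. -/
abbrev Sq (D : CartanDatum ι) : Type _ :=
  invLim (fun N => UhLevel D N ⊗[Kh] UhLevel D N)
    (fun N => Algebra.TensorProduct.map (UhLevel.trans D N) (UhLevel.trans D N))

theorem map_rLevel_gens (D : CartanDatum ι) (w : List ι) (N : ℕ) :
    Algebra.TensorProduct.map (UhLevel.trans D N) (UhLevel.trans D N)
      (rLevel D w (N + 1) (UhLevel.gens D (N + 1))) = rLevel D w N (UhLevel.gens D N) := by
  rw [map_rLevel, UhLevel.gens_map_trans, rLevel_succ D w (UhLevel.sat_gens D N).hN]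

theorem isUnit_rLevel_gens (D : CartanDatum ι) (w : List ι) (N : ℕ) :
    IsUnit (rLevel D w N (UhLevel.gens D N)) :=
  isUnit_rLevel D w (UhLevel.sat_gens D N).hN _

/-- The universal `R`-matrix of `U_h`, an invertible element of `U_h ⊗̂ U_h`. The word `w` is a
reduced expression of the longest element of the Weyl group. -/
def universalR (D : CartanDatum ι) (w : List ι) : (Sq D)ˣ where
  val := ⟨fun N => rLevel D w N (UhLevel.gens D N), map_rLevel_gens D w⟩
  inv := ⟨fun N => ((isUnit_rLevel_gens D w N).unit⁻¹ : Units _), fun N => by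
    have e : Units.map (Algebra.TensorProduct.map (UhLevel.trans D N)
        (UhLevel.trans D N)).toRingHom.toMonoidHom (isUnit_rLevel_gens D w (N + 1)).unit =
        (isUnit_rLevel_gens D w N).unit := Units.ext (map_rLevel_gens D w N)
    exact congrArg (fun v : (UhLevel D N ⊗[Kh] UhLevel D N)ˣ => (v⁻¹).val) e⟩
  val_inv := Subtype.ext (funext fun N => (isUnit_rLevel_gens D w N).mul_val_inv)
  inv_val := Subtype.ext (funext fun N => (isUnit_rLevel_gens D w N).val_inv_mul)

/-- For a linear functional `f` on `U_h` the bilinear map `(v, u) ↦ f(v) u`, modulo `h ^ N`. -/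
def pairLevel {D : CartanDatum ι} (f : Uh D →ₗ[Kh] Kh) (N : ℕ) :
    UhLevel D N →ₗ[Kh] UhLevel D N →ₗ[Kh] UhLevel D N :=
  ((LinearMap.ker (ev D N).toLinearMap).liftQ ((LinearMap.lsmul Kh (UhLevel D N)).comp f) (by
    intro x hx
    obtain ⟨y, rfl⟩ := ker_ev D N x hx
    ext u
    simp [hpow_smul (UhLevel.sat_gens D N).hN])) ∘ₗ
  ((ev D N).toLinearMap.quotKerEquivOfSurjective (ev_surjective D N)).symm.toLinearMap

theorem pairLevel_ev {D : CartanDatum ι} (f : Uh D →ₗ[Kh] Kh) (N : ℕ) (v : Uh D)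
    (u : UhLevel D N) : pairLevel f N (ev D N v) u = f v • u := by
  have : ((ev D N).toLinearMap.quotKerEquivOfSurjective (ev_surjective D N)).symm (ev D N v) =
      Submodule.Quotient.mk v := by
    rw [LinearEquiv.symm_apply_eq]; rfl
  simp only [pairLevel, LinearMap.comp_apply, LinearEquiv.coe_coe, this]
  rfl

theorem trans_pairLevel {D : CartanDatum ι} (f : Uh D →ₗ[Kh] Kh) (N : ℕ)
    (v u : UhLevel D (N + 1)) : UhLevel.trans D N (pairLevel f (N + 1) v u) =
      pairLevel f N (UhLevel.trans D N v) (UhLevel.trans D N u) := by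
  obtain ⟨v, rfl⟩ := ev_surjective D _ v
  rw [trans_ev, pairLevel_ev, pairLevel_ev, map_smul]

/-- The map `f ⊗ id : U_h ⊗̂ U_h → U_h`. -/
def contractLeft {D : CartanDatum ι} (f : Uh D →ₗ[Kh] Kh) : Sq D →ₗ[Kh] Uh D where
  toFun x := ⟨fun N => TensorProduct.lift (pairLevel f N) (x.1 N), fun N => by
    change UhLevel.trans D N (TensorProduct.lift (pairLevel f (N + 1)) (x.1 (N + 1))) =
      TensorProduct.lift (pairLevel f N) (x.1 N)
    rw [← x.2 N]
    induction x.1 (N + 1) using TensorProduct.induction_on with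
    | zero => simp
    | tmul a b => simp [trans_pairLevel]
    | add a b ha hb => simp only [map_add, ha, hb]⟩
  map_add' x y := Subtype.ext (funext fun N => by simp)
  map_smul' r x := Subtype.ext (funext fun N => by simp)

/-- The map `id ⊗ f : U_h ⊗̂ U_h → U_h`. -/
def contractRight {D : CartanDatum ι} (f : Uh D →ₗ[Kh] Kh) : Sq D →ₗ[Kh] Uh D where
  toFun x := ⟨fun N => TensorProduct.lift (pairLevel f N).flip (x.1 N), fun N => by
    change UhLevel.trans D N (TensorProduct.lift (pairLevel f (N + 1)).flip (x.1 (N + 1))) =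
      TensorProduct.lift (pairLevel f N).flip (x.1 N)
    rw [← x.2 N]
    induction x.1 (N + 1) using TensorProduct.induction_on with
    | zero => simp
    | tmul a b => simp [trans_pairLevel]
    | add a b ha hb => simp only [map_add, ha, hb]⟩
  map_add' x y := Subtype.ext (funext fun N => by simp)
  map_smul' r x := Subtype.ext (funext fun N => by simp)

end Uh
end

section frt
variable {ι : Type*} [Fintype ι] [DecidableEq ι] (D : CartanDatum ι) (w : List ι)
variable {V κ : Type*} [AddCommGroup V] [Module Kh V]
variable (T : Uh D →ₐ[Kh] Module.End Kh V) (b : Module.Basis κ Kh V)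

/-- The matrix coefficient `T_{kj}` of a representation: `T(u) x_j = ∑_k T_{kj}(u) x_k`. -/
def matrixCoeff {D : CartanDatum ι} (T : Uh D →ₐ[Kh] Module.End Kh V) (b : Module.Basis κ Kh V)
    (k j : κ) : Uh D →ₗ[Kh] Kh where
  toFun u := b.repr (T u (b j)) k
  map_add' x y := by simp
  map_smul' r x := by simp

/-- `l⁺_{kj}`, given by `(id ⊗ T)(R)(1 ⊗ x_j) = ∑_k l⁺_{kj} ⊗ x_k`. -/
def lPlus (k j : κ) : Uh D := Uh.contractRight (matrixCoeff T b k j) (Uh.universalR D w).val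

/-- `l⁻_{kj}`, given by `(T ⊗ id)(R⁻¹)(x_j ⊗ 1) = ∑_k x_k ⊗ l⁻_{kj}`. -/
def lMinus (k j : κ) : Uh D := Uh.contractLeft (matrixCoeff T b k j) (Uh.universalR D w).inv

/-- The FRT generators `(m⁺)^k_j = S(l⁺_{kj})`. -/
def mPlus (k j : κ) : Uh D := Uh.antipode D (lPlus D w T b k j)

/-- The FRT generators `(m⁻)^k_j = S(l⁻_{kj})`. -/
def mMinus (k j : κ) : Uh D := Uh.antipode D (lMinus D w T b k j)

end frt

section sum
variable {n : ℕ} {ι : Fin n → Type*} [∀ i, Fintype (ι i)] [∀ i, DecidableEq (ι i)]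

/-- The datum of `g_1 ⊕ ⋯ ⊕ g_n`: the block diagonal Cartan matrix. -/
def CartanDatum.sum (D : ∀ i, CartanDatum (ι i)) : CartanDatum (Σ i, ι i) where
  A := Matrix.blockDiagonal' fun i => (D i).A
  d p := (D p.1).d p.2
  diag p := by
    obtain ⟨i, a⟩ := p
    rw [Matrix.blockDiagonal'_apply_eq, (D i).diag]
  nonpos p r h := by
    obtain ⟨i, a⟩ := p
    obtain ⟨j, b⟩ := r
    by_cases hij : i = j
    · subst hij
      rw [Matrix.blockDiagonal'_apply_eq]
      exact (D i).nonpos a b fun e => h (by rw [e])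
    · rw [Matrix.blockDiagonal'_apply_ne _ _ _ hij]
  d_pos p := (D p.1).d_pos p.2
  symm p r := by
    obtain ⟨i, a⟩ := p
    obtain ⟨j, b⟩ := r
    by_cases hij : i = j
    · subst hij
      rw [Matrix.blockDiagonal'_apply_eq, Matrix.blockDiagonal'_apply_eq]
      exact (D i).symm a b
    · rw [Matrix.blockDiagonal'_apply_ne _ _ _ hij, Matrix.blockDiagonal'_apply_ne _ _ _ (Ne.symm hij)]
      simp
  posDef x hx := by
    have e : ∀ i (a : ι i), ∑ r : Σ j, ι j, x ⟨i, a⟩ * ((D i).d a *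
        (Matrix.blockDiagonal' (fun i => (D i).A) ⟨i, a⟩ r : ℤ)) * x r =
        ∑ b, x ⟨i, a⟩ * ((D i).d a * (D i).A a b) * x ⟨i, b⟩ := by
      intro i a
      rw [Fintype.sum_sigma, Finset.sum_eq_single i]
      · simp [Matrix.blockDiagonal'_apply_eq]
      · intro j _ hj
        refine Finset.sum_eq_zero fun b _ => ?_
        rw [Matrix.blockDiagonal'_apply_ne _ _ _ (Ne.symm hj)]; simp
      · simp
    rw [Fintype.sum_sigma]
    simp only [e]
    have h0 : ∀ i, (fun a => x ⟨i, a⟩) ≠ 0 → 0 < ∑ a, ∑ b, x ⟨i, a⟩ * ((D i).d a * (D i).A a b) * x ⟨i, b⟩ :=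
      fun i hi => (D i).posDef (fun a => x ⟨i, a⟩) hi
    obtain ⟨⟨i, a⟩, hia⟩ := Function.ne_iff.1 hx
    refine Finset.sum_pos' (fun j _ => ?_) ⟨i, Finset.mem_univ _, h0 i fun h => hia (congrFun h a)⟩
    by_cases hj : (fun a => x ⟨j, a⟩) = 0
    · exact (Finset.sum_eq_zero fun a _ => Finset.sum_eq_zero fun b _ => by
        simp [show x ⟨j, a⟩ = 0 from congrFun hj a]).ge
    · exact (h0 j hj).le

/-- The subword of a word consisting of its letters from the `i`-th block. -/
def restrictWord (i : Fin n) (u : List (Σ i, ι i)) : List (ι i) :=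
  u.filterMap fun p => if h : p.1 = i then some (h ▸ p.2) else none

/-- The completed tensor product `U_h(g_1) ⊗̂ ⋯ ⊗̂ U_h(g_n)`. -/
abbrev UhTensor (D : ∀ i, CartanDatum (ι i)) : Type _ :=
  invLim (fun N => ⨂[Kh] i, UhLevel (D i) N) (fun N => piTensorMap fun i => UhLevel.trans (D i) N)

/-- The element `x_1 ⊗ ⋯ ⊗ x_n` of the completed tensor product. -/
def UhTensor.tprod {D : ∀ i, CartanDatum (ι i)} (x : ∀ i, Uh (D i)) : UhTensor D :=
  ⟨fun N => PiTensorProduct.tprod Kh fun i => Uh.ev (D i) N (x i), fun N => by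
    simp only [piTensorMap_tprod, Uh.trans_ev]⟩

/-- The element `1 ⊗ ⋯ ⊗ x ⊗ ⋯ ⊗ 1` with `x` in the `i`-th place. -/
def UhTensor.single {D : ∀ i, CartanDatum (ι i)} (i : Fin n) (x : Uh (D i)) : UhTensor D :=
  UhTensor.tprod (Function.update 1 i x)

/-- An isomorphism `U_h(g_1 ⊕ ⋯ ⊕ g_n) ≃ U_h(g_1) ⊗̂ ⋯ ⊗̂ U_h(g_n)` is the canonical one if it maps
each generator of the `i`-th block to that generator in the `i`-th tensor factor. -/
def IsCanonicalIso (D : ∀ i, CartanDatum (ι i))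
    (Φ : Uh (CartanDatum.sum D) ≃ₐ[Kh] UhTensor D) : Prop :=
  (∀ i a, Φ ((Uh.gens (CartanDatum.sum D)).H ⟨i, a⟩) = UhTensor.single i ((Uh.gens (D i)).H a)) ∧
  (∀ i a, Φ ((Uh.gens (CartanDatum.sum D)).E ⟨i, a⟩) = UhTensor.single i ((Uh.gens (D i)).E a)) ∧
  (∀ i a, Φ ((Uh.gens (CartanDatum.sum D)).F ⟨i, a⟩) = UhTensor.single i ((Uh.gens (D i)).F a))

/-- `S` is the representation `T_{V_1 ⊗ ⋯ ⊗ V_n}` of `U_h(g_1 ⊕ ⋯ ⊕ g_n)` on `V_1 ⊗ ⋯ ⊗ V_n`: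
`u_1 ⊗ ⋯ ⊗ u_n` acts as `T_1(u_1) ⊗ ⋯ ⊗ T_n(u_n)`. -/
def IsTensorRep (D : ∀ i, CartanDatum (ι i))
    (Φ : Uh (CartanDatum.sum D) ≃ₐ[Kh] UhTensor D) {V : Fin n → Type*} [∀ i, AddCommGroup (V i)]
    [∀ i, Module Kh (V i)] (T : ∀ i, Uh (D i) →ₐ[Kh] Module.End Kh (V i))
    (S : Uh (CartanDatum.sum D) →ₐ[Kh] Module.End Kh (⨂[Kh] i, V i)) : Prop :=
  ∀ (u : ∀ i, Uh (D i)) (v : ∀ i, V i), S (Φ.symm (UhTensor.tprod u)) (PiTensorProduct.tprod Kh v) =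
    PiTensorProduct.tprod Kh fun i => T i (u i) (v i)

end sum

section ext
variable {ι : Type*} [Fintype ι] [DecidableEq ι]

/-- For a field `k` of Laurent series in `h` the `k`-subalgebra of `A[h⁻¹] = ℂ((h)) ⊗ A` generated by
a subset of `A`. -/
def adjoinField (k : Subfield (LaurentSeries ℂ)) {A : Type*} [Ring A] [Algebra Kh A] (G : Set A) :
    Subalgebra k (LaurentSeries ℂ ⊗[Kh] A) :=
  Algebra.adjoin k ((fun x => 1 ⊗ₜ[Kh] x) '' G)

/-- The extended algebra `U_q^ext` over a field `k` of Laurent series in `h` (for instance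
`ℂ(q^{1/m})` with `q = e^h`): the `k`-subalgebra of `U_h[h⁻¹]` generated by the FRT generators. -/
def UqExt (k : Subfield (LaurentSeries ℂ)) (D : CartanDatum ι) (w : List ι)
    {V κ : Type*} [AddCommGroup V] [Module Kh V]
    (T : Uh D →ₐ[Kh] Module.End Kh V) (b : Module.Basis κ Kh V) :
    Subalgebra k (LaurentSeries ℂ ⊗[Kh] Uh D) :=
  adjoinField k ({x | ∃ p j, x = mPlus D w T b p j} ∪ {x | ∃ p j, x = mMinus D w T b p j})

end ext

end QG

end

/-!
Each ingredient of the FRT construction for `g_1 ⊕ ⋯ ⊕ g_n` is the tensor product of the ingredients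
for the `g_i`, and the contractions that define the FRT generators respect this.

*Algebras.* The Cartan matrix is block diagonal, so generators from different blocks commute (for
`E`, `E` and for `F`, `F` this is the Serre relation of degree one). With the universal property of
the tensor product of noncommutative algebras (`commLift`) this identifies
`U_h(g_1 ⊕ ⋯ ⊕ g_n) / h ^ N` with `⨂ U_h(g_i) / h ^ N` (`UhLevel.sumEquiv`), and the inverse limit
gives the isomorphism `Uh.sumEquiv`.

*The `R`-matrix.* The matrix `B` is block diagonal, so the Cartan part of `R` is a product over the
blocks. A braid automorphism `T_i` changes the generators of its own block only (`braid_sumGens`),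
so the root vectors for a word are a shuffle of the root vectors for its subwords. Factors from
different blocks commute, hence `R` is the image of `R_1 ⊗ ⋯ ⊗ R_n` under the interchange
`⨂ (A_i ⊗ A_i) → (⨂ A_i) ⊗ (⨂ A_i)` (`rLevel_sumGens`), and so is its inverse.

*The representation.* Since `End (⨂ V_i)` is a free module of finite rank, it is `h`-adically
complete, so the actions of the `⨂ U_h(g_i) / h ^ N` on `⨂ V_i` modulo `h ^ N` glue
(`exists_isTensorRep`). Pure tensors span modulo `h ^ N`, which gives uniqueness
(`IsTensorRep.unique`).

*FRT generators.* Matrix coefficients on pure tensors are products of matrix coefficients, so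
contracting the product of the `R_i` yields the pure tensor of the contractions of the `R_i`
(`Uh.contract_of_isProd`), and the antipode acts factorwise (`Uh.sumEquiv_antipode`).
-/

noncomputable section

namespace QG

/-! ### Tensor products of noncommutative algebras -/

section commuting
variable {R κ : Type*} [CommSemiring R] [Fintype κ] [DecidableEq κ] {A : κ → Type*}
  [∀ i, Semiring (A i)] [∀ i, Algebra R (A i)] {C : Type*} [Semiring C] [Algebra R C]

/-- The product `x ↦ ∏ f i (x i)` of homomorphisms `f i : A i → C` with pairwise commuting images. -/
def commProd (f : ∀ i, A i →ₐ[R] C)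
    (hf : Pairwise fun i j => ∀ x y, Commute (f i x) (f j y)) : (∀ i, A i) →* C :=
  MonoidHom.noncommPiCoprod (fun i => (f i).toRingHom.toMonoidHom) hf

theorem commProd_mulSingle (f : ∀ i, A i →ₐ[R] C)
    (hf : Pairwise fun i j => ∀ x y, Commute (f i x) (f j y)) (i : κ) (x : A i) :
    commProd f hf (Pi.mulSingle i x) = f i x :=
  MonoidHom.noncommPiCoprod_mulSingle (ϕ := fun i => (f i).toRingHom.toMonoidHom) (hcomm := hf) i x

theorem commProd_update (f : ∀ i, A i →ₐ[R] C)
    (hf : Pairwise fun i j => ∀ x y, Commute (f i x) (f j y)) (m : ∀ i, A i) (i : κ) (x : A i) :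
    commProd f hf (Function.update m i x) = f i x * commProd f hf (Function.update m i 1) := by
  have e : Function.update m i x = Pi.mulSingle i x * Function.update m i 1 := by
    ext j
    by_cases h : j = i
    · subst h; simp
    · simp [h]
  rw [e, map_mul, commProd_mulSingle]

/-- The homomorphism `⨂ A i → C` determined by homomorphisms `A i → C` with pairwise commuting
images: the universal property of the tensor product of noncommutative algebras. -/
def commLift (f : ∀ i, A i →ₐ[R] C)
    (hf : Pairwise fun i j => ∀ x y, Commute (f i x) (f j y)) : (⨂[R] i, A i) →ₐ[R] C :=
  PiTensorProduct.liftAlgHom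
    { toFun := commProd f hf
      map_update_add' := fun {inst} m i x y => by
        rw [commProd_update, commProd_update f hf m i x, commProd_update f hf m i y, map_add,
          add_mul]
      map_update_smul' := fun {inst} m i c x => by
        rw [commProd_update, commProd_update f hf m i x, map_smul, smul_mul_assoc] }
    (map_one (commProd f hf)) (map_mul (commProd f hf))

@[simp]
theorem commLift_single (f : ∀ i, A i →ₐ[R] C)
    (hf : Pairwise fun i j => ∀ x y, Commute (f i x) (f j y)) (i : κ) (x : A i) :
    commLift f hf (PiTensorProduct.singleAlgHom i x) = f i x := by
  rw [commLift, PiTensorProduct.singleAlgHom_apply, PiTensorProduct.liftAlgHom_apply]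
  exact (PiTensorProduct.lift.tprod _).trans (commProd_mulSingle f hf i x)

theorem commute_single {i j : κ} (h : i ≠ j) (x : A i) (y : A j) :
    Commute (PiTensorProduct.singleAlgHom (R := R) (A := A) i x)
      (PiTensorProduct.singleAlgHom (R := R) j y) :=
  (Pi.mulSingle_commute h x y).tprod

/-- Left multiplication in one factor of a pure tensor. -/
theorem tprod_update_mul (i : κ) (a : A i) (x : ∀ i, A i) :
    PiTensorProduct.tprod R (Function.update x i (a * x i)) =
      PiTensorProduct.singleAlgHom i a * PiTensorProduct.tprod R x := by
  rw [PiTensorProduct.singleAlgHom_apply, PiTensorProduct.tprod_mul_tprod]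
  congr 1
  ext j
  by_cases h : j = i
  · subst h; simp
  · simp [h]

end commuting

section interchange
variable {R κ : Type*} [CommSemiring R] [Fintype κ] [DecidableEq κ] {A B : κ → Type*}
  [∀ i, Semiring (A i)] [∀ i, Algebra R (A i)] [∀ i, Semiring (B i)] [∀ i, Algebra R (B i)]

variable (R A B) in
/-- The homomorphism `A i ⊗ B i → (⨂ A i) ⊗ (⨂ B i)` that puts both factors into the `i`-th place. -/
def singleTmul (i : κ) : A i ⊗[R] B i →ₐ[R] (⨂[R] i, A i) ⊗[R] (⨂[R] i, B i) :=
  Algebra.TensorProduct.map (PiTensorProduct.singleAlgHom i) (PiTensorProduct.singleAlgHom i)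

theorem singleTmul_tmul (i : κ) (a : A i) (b : B i) :
    singleTmul R A B i (a ⊗ₜ[R] b) = PiTensorProduct.singleAlgHom (R := R) i a ⊗ₜ[R]
      PiTensorProduct.singleAlgHom (R := R) i b := rfl

theorem commute_singleTmul : Pairwise fun i j => ∀ (x : A i ⊗[R] B i) (y : A j ⊗[R] B j),
    Commute (singleTmul R A B i x) (singleTmul R A B j y) := by
  intro i j hij x y
  induction x using TensorProduct.induction_on with
  | zero => simp
  | add a b ha hb => rw [map_add]; exact ha.add_left hb
  | tmul a b =>
    induction y using TensorProduct.induction_on with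
    | zero => simp
    | add c d hc hd => rw [map_add]; exact hc.add_right hd
    | tmul c d =>
      rw [singleTmul_tmul, singleTmul_tmul, Commute, SemiconjBy,
        Algebra.TensorProduct.tmul_mul_tmul, Algebra.TensorProduct.tmul_mul_tmul,
        (commute_single hij a c).eq, (commute_single hij b d).eq]

variable (R A B) in
/-- The homomorphism `⨂ (A i ⊗ B i) → (⨂ A i) ⊗ (⨂ B i)` that interchanges the factors. -/
def interchange : (⨂[R] i, A i ⊗[R] B i) →ₐ[R] (⨂[R] i, A i) ⊗[R] (⨂[R] i, B i) :=
  commLift (singleTmul R A B) commute_singleTmul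

@[simp]
theorem interchange_single (i : κ) (x : A i ⊗[R] B i) :
    interchange R A B (PiTensorProduct.singleAlgHom i x) = singleTmul R A B i x := by
  unfold interchange
  exact commLift_single (singleTmul R A B) commute_singleTmul i x

theorem interchange_tprod (a : ∀ i, A i) (b : ∀ i, B i) :
    interchange R A B (PiTensorProduct.tprod R fun i => a i ⊗ₜ[R] b i) =
      PiTensorProduct.tprod R a ⊗ₜ[R] PiTensorProduct.tprod R b := by
  let p : (∀ i, A i × B i) →* (⨂[R] i, A i ⊗[R] B i) :=
    { toFun x := PiTensorProduct.tprod R fun i => (x i).1 ⊗ₜ[R] (x i).2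
      map_one' := rfl
      map_mul' x y := by
        rw [PiTensorProduct.tprod_mul_tprod]
        exact congrArg (PiTensorProduct.tprod R) (funext fun i => by simp) }
  let q : (∀ i, A i × B i) →* (⨂[R] i, A i) ⊗[R] (⨂[R] i, B i) :=
    { toFun x := (PiTensorProduct.tprod R fun i => (x i).1) ⊗ₜ[R]
        (PiTensorProduct.tprod R fun i => (x i).2)
      map_one' := rfl
      map_mul' x y := by
        rw [Algebra.TensorProduct.tmul_mul_tmul, PiTensorProduct.tprod_mul_tprod,
          PiTensorProduct.tprod_mul_tprod]
        rfl }
  have : ((interchange R A B).toRingHom.toMonoidHom).comp p = q := by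
    refine MonoidHom.pi_ext fun i x => ?_
    have e1 : p (Pi.mulSingle i x) = PiTensorProduct.singleAlgHom i (x.1 ⊗ₜ[R] x.2) := by
      rw [PiTensorProduct.singleAlgHom_apply]
      refine congrArg (PiTensorProduct.tprod R) (funext fun j => ?_)
      by_cases h : j = i
      · subst h; simp
      · simp [h, Algebra.TensorProduct.one_def]
    have e2 : q (Pi.mulSingle i x) = PiTensorProduct.singleAlgHom i x.1 ⊗ₜ[R]
        PiTensorProduct.singleAlgHom i x.2 := by
      rw [PiTensorProduct.singleAlgHom_apply, PiTensorProduct.singleAlgHom_apply]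
      refine congrArg₂ (fun a b => PiTensorProduct.tprod R a ⊗ₜ[R] PiTensorProduct.tprod R b)
        (funext fun j => ?_) (funext fun j => ?_)
      all_goals
        by_cases h : j = i
        · subst h; simp
        · simp [h]
    rw [e2]
    change interchange R A B (p (Pi.mulSingle i x)) = _
    rw [e1, interchange_single, singleTmul_tmul]
  exact DFunLike.congr_fun this fun i => (a i, b i)

end interchange

/-- Two multilinear maps on a family of tensor products are equal if they agree on families of pure
tensors. -/
theorem multilinear_ext_tmul {R κ : Type*} [CommRing R] [Finite κ]
    {A B : κ → Type*} [∀ i, AddCommGroup (A i)] [∀ i, Module R (A i)] [∀ i, AddCommGroup (B i)]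
    [∀ i, Module R (B i)] {M : Type*} [AddCommGroup M] [Module R M]
    {f g : MultilinearMap R (fun i => A i ⊗[R] B i) M}
    (h : ∀ (a : ∀ i, A i) (b : ∀ i, B i),
      f (fun i => a i ⊗ₜ[R] b i) = g (fun i => a i ⊗ₜ[R] b i)) : f = g := by
  classical
  have := Fintype.ofFinite κ
  -- Induction on the set of places where the tensor is not known to be pure.
  have key : ∀ (s : Finset κ) (x : ∀ i, A i ⊗[R] B i),
      (∀ i, i ∉ s → ∃ a b, x i = a ⊗ₜ[R] b) → f x = g x := by
    intro s
    induction s using Finset.induction_on with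
    | empty =>
      intro x hx
      choose a b hab using fun i => hx i (Finset.notMem_empty i)
      rw [show x = fun i => a i ⊗ₜ[R] b i from funext hab, h]
    | insert i s _ ih =>
      intro x hx
      have step : ∀ y : A i ⊗[R] B i, f (Function.update x i y) = g (Function.update x i y) := by
        intro y
        induction y using TensorProduct.induction_on with
        | zero => rw [f.map_update_zero, g.map_update_zero]
        | add c d hc hd => rw [f.map_update_add, g.map_update_add, hc, hd]
        | tmul a b =>
          refine ih _ fun j hj => ?_
          by_cases hji : j = i
          · subst hji; exact ⟨a, b, by simp⟩
          · rw [Function.update_of_ne hji]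
            exact hx j (by simp [hji, hj])
      simpa using step (x i)
  exact MultilinearMap.ext fun x => key Finset.univ x (by simp)

/-! ### The universal `R`-matrix of a direct sum -/

namespace CartanDatum

/-- The matrix `(a_{ij} / d_j)` is invertible, because `(d_i a_{ij})` is positive definite. -/
theorem isUnit_matrix {ι : Type*} [Fintype ι] [DecidableEq ι] (D : CartanDatum ι) :
    IsUnit (Matrix.of fun i j => (D.A i j : ℚ) / D.d j) := by
  rw [← Matrix.mulVec_injective_iff_isUnit]
  refine (injective_iff_map_eq_zero (Matrix.mulVecLin _)).2 fun x hx => ?_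
  have hx' : ∀ i, ∑ j, (D.A i j : ℚ) / D.d j * x j = 0 := fun i => congrFun hx i
  by_contra hne
  have hy : (fun j => x j / D.d j) ≠ 0 := by
    intro h0
    refine hne (funext fun j => ?_)
    simpa [(D.d_pos j).ne'] using congrFun h0 j
  refine (D.posDef _ hy).ne' (Finset.sum_eq_zero fun i _ => ?_)
  calc ∑ j, x i / D.d i * (D.d i * D.A i j) * (x j / D.d j)
      = x i / D.d i * D.d i * ∑ j, (D.A i j : ℚ) / D.d j * x j := by
        rw [Finset.mul_sum]
        refine Finset.sum_congr rfl fun j _ => ?_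
        ring
    _ = 0 := by rw [hx', mul_zero]

variable {n : ℕ} {ι : Fin n → Type*} [∀ i, Fintype (ι i)] [∀ i, DecidableEq (ι i)]
  (D : ∀ i, CartanDatum (ι i))

@[simp]
theorem sum_A_same (i : Fin n) (a b : ι i) : (sum D).A ⟨i, a⟩ ⟨i, b⟩ = (D i).A a b :=
  Matrix.blockDiagonal'_apply_eq (fun i => (D i).A) i a b

theorem sum_A_ne {i j : Fin n} (h : i ≠ j) (a : ι i) (b : ι j) : (sum D).A ⟨i, a⟩ ⟨j, b⟩ = 0 :=
  Matrix.blockDiagonal'_apply_ne (fun i => (D i).A) a b h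

theorem sum_B : (sum D).B = Matrix.blockDiagonal' fun i => (D i).B := by
  have e : (Matrix.of fun p r => ((sum D).A p r : ℚ) / (sum D).d r) =
      Matrix.blockDiagonal' fun i => Matrix.of fun a b => ((D i).A a b : ℚ) / (D i).d b := by
    ext ⟨i, a⟩ ⟨j, b⟩
    by_cases h : i = j
    · subst h
      rw [Matrix.blockDiagonal'_apply_eq, Matrix.of_apply, sum_A_same]
      rfl
    · rw [Matrix.blockDiagonal'_apply_ne _ _ _ h, Matrix.of_apply, sum_A_ne D h]
      simp
  rw [B, e]
  refine Matrix.inv_eq_right_inv ?_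
  rw [← Matrix.blockDiagonal'_mul, ← Matrix.blockDiagonal'_one]
  congr 1
  funext i
  exact Matrix.mul_nonsing_inv _ ((Matrix.isUnit_iff_isUnit_det _).1 (D i).isUnit_matrix)

end CartanDatum

section tensorPower

variable {κ : Type*} [Fintype κ] [DecidableEq κ] {A : κ → Type*} [∀ i, Ring (A i)]
  [∀ i, Algebra Kh (A i)]

/-- The index set has to be nonempty: the empty tensor product is `ℂ[[h]]`, where `h ^ N ≠ 0`. -/
theorem piTensor_hN [Nonempty κ] {N : ℕ} (hN : ∀ i, algebraMap Kh (A i) (PowerSeries.X ^ N) = 0) :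
    algebraMap Kh (⨂[Kh] i, A i) (PowerSeries.X ^ N) = 0 := by
  obtain ⟨i⟩ := ‹Nonempty κ›
  rw [← (PiTensorProduct.singleAlgHom (R := Kh) (A := A) i).commutes, hN, map_zero]

theorem hexp_apply_zero {C : Type*} [Ring C] [Algebra Kh C] {N : ℕ}
    (hN : algebraMap Kh C (PowerSeries.X ^ N) = 0) (c : ℚ) : hexp N c (0 : C) = 1 := by
  rw [hexp_add_of_commute hN 0 0 c 0 0 0 (Commute.refl _) (by simp), hexp_zero hN, one_mul]

theorem hexp_add {C : Type*} [Ring C] [Algebra Kh C] {N : ℕ}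
    (hN : algebraMap Kh C (PowerSeries.X ^ N) = 0) (c : ℚ) {x y : C} (h : Commute x y) :
    hexp N c (x + y) = hexp N c x * hexp N c y :=
  hexp_add_of_commute hN c c c x y _ h (smul_add _ _ _)

/-- The exponential of a sum of elements of the different tensor factors is a pure tensor. -/
theorem tprod_hexp [Nonempty κ] {N : ℕ} (hN : ∀ i, algebraMap Kh (A i) (PowerSeries.X ^ N) = 0)
    (c : ℚ) (x : ∀ i, A i) :
    PiTensorProduct.tprod Kh (fun i => hexp N c (x i)) =
      hexp N c (∑ i, PiTensorProduct.singleAlgHom (R := Kh) i (x i)) := by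
  have hN' := piTensor_hN hN
  have key : ∀ s : Finset κ,
      PiTensorProduct.tprod Kh (fun i => if i ∈ s then hexp N c (x i) else 1) =
        hexp N c (∑ i ∈ s, PiTensorProduct.singleAlgHom (R := Kh) i (x i)) := by
    intro s
    induction s using Finset.induction_on with
    | empty => simp [hexp_apply_zero hN', PiTensorProduct.one_def, Pi.one_def]
    | insert i s hi ih =>
      rw [Finset.sum_insert hi, hexp_add hN', ← ih, ← map_hexp, ← tprod_update_mul]
      · refine congrArg (PiTensorProduct.tprod Kh) (funext fun j => ?_)
        by_cases h : j = i
        · subst h; simp [hi]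
        · simp [h]
      · exact Commute.sum_right _ _ _ fun j hj =>
          commute_single (ne_of_mem_of_not_mem hj hi).symm _ _
  simpa using key Finset.univ

end tensorPower

section sumGens

theorem Gens.ext {κ C : Type*} {t t' : Gens κ C} (hH : ∀ p, t.H p = t'.H p)
    (hE : ∀ p, t.E p = t'.E p) (hF : ∀ p, t.F p = t'.F p) : t = t' := by
  cases t
  cases t'
  congr <;> funext p
  exacts [hH p, hE p, hF p]

variable {n : ℕ} {ι : Fin n → Type*} [∀ i, Fintype (ι i)] [∀ i, DecidableEq (ι i)]
  {A : Fin n → Type*} [∀ i, Ring (A i)] [∀ i, Algebra Kh (A i)] (D : ∀ i, CartanDatum (ι i))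

/-- The generators of `g_1 ⊕ ⋯ ⊕ g_n` in a tensor product of algebras: those of the `i`-th block are
placed in the `i`-th tensor factor. -/
def sumGens (t : ∀ i, Gens (ι i) (A i)) : Gens (Σ i, ι i) (⨂[Kh] i, A i) where
  H p := PiTensorProduct.singleAlgHom p.1 ((t p.1).H p.2)
  E p := PiTensorProduct.singleAlgHom p.1 ((t p.1).E p.2)
  F p := PiTensorProduct.singleAlgHom p.1 ((t p.1).F p.2)

theorem serre_one {C : Type*} [Ring C] [Algebra Kh C] (c : ℚ) (x y : C) :
    serre 1 c x y = x * y - y * x := by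
  have h1 : qint c 1 = 1 := by simp [qint, qpow_zero]
  simp [serre, Finset.sum_range_succ, qbinom, qfact, h1, sub_eq_add_neg]

theorem sat_sumGens (hn : 0 < n) {N : ℕ} {t : ∀ i, Gens (ι i) (A i)}
    (ht : ∀ i, Sat (D i) N (t i)) : Sat (CartanDatum.sum D) N (sumGens t) := by
  have : Nonempty (Fin n) := ⟨⟨0, hn⟩⟩
  have hs := fun i => (ht i).map (PiTensorProduct.singleAlgHom (R := Kh) i)
  intro x y hxy
  cases hxy with
  | HH p r =>
    obtain ⟨i, a⟩ := p
    obtain ⟨j, b⟩ := r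
    by_cases h : i = j
    · subst h; exact hs i _ _ (Rel.HH a b)
    · exact sub_eq_zero.2 (commute_single h _ _)
  | HE p r =>
    obtain ⟨i, a⟩ := p
    obtain ⟨j, b⟩ := r
    by_cases h : i = j
    · subst h; rw [CartanDatum.sum_A_same]; exact hs i _ _ (Rel.HE a b)
    · rw [CartanDatum.sum_A_ne D h]
      exact (sub_eq_zero.2 (commute_single h _ _)).trans (zero_zsmul _).symm
  | HF p r =>
    obtain ⟨i, a⟩ := p
    obtain ⟨j, b⟩ := r
    by_cases h : i = j
    · subst h; rw [CartanDatum.sum_A_same]; exact hs i _ _ (Rel.HF a b)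
    · rw [CartanDatum.sum_A_ne D h, neg_zero]
      exact (sub_eq_zero.2 (commute_single h _ _)).trans (zero_zsmul _).symm
  | EF p => exact hs p.1 _ _ (Rel.EF p.2)
  | EF_ne p r hpr =>
    obtain ⟨i, a⟩ := p
    obtain ⟨j, b⟩ := r
    by_cases h : i = j
    · subst h; exact hs i _ _ (Rel.EF_ne a b fun e => hpr (by rw [e]))
    · exact sub_eq_zero.2 (commute_single h _ _)
  | serreE p r hpr =>
    obtain ⟨i, a⟩ := p
    obtain ⟨j, b⟩ := r
    by_cases h : i = j
    · subst h; rw [CartanDatum.sum_A_same]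
      exact hs i _ _ (Rel.serreE a b fun e => hpr (by rw [e]))
    · rw [CartanDatum.sum_A_ne D h]
      exact (serre_one _ _ _).trans (sub_eq_zero.2 (commute_single h _ _))
  | serreF p r hpr =>
    obtain ⟨i, a⟩ := p
    obtain ⟨j, b⟩ := r
    by_cases h : i = j
    · subst h; rw [CartanDatum.sum_A_same]
      exact hs i _ _ (Rel.serreF a b fun e => hpr (by rw [e]))
    · rw [CartanDatum.sum_A_ne D h]
      exact (serre_one _ _ _).trans (sub_eq_zero.2 (commute_single h _ _))
  | hpow => exact piTensor_hN fun i => (ht i).hN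

/-- Lusztig's automorphism for a letter of the `i`-th block changes the generators of that block
only. -/
theorem braid_sumGens (N : ℕ) (t : ∀ i, Gens (ι i) (A i)) (i : Fin n) (a : ι i) :
    (sumGens t).braid (CartanDatum.sum D) N ⟨i, a⟩ =
      sumGens (Function.update t i ((t i).braid (D i) N a)) := by
  have hs := Gens.map_braid (D i) N a (t i) (PiTensorProduct.singleAlgHom (R := Kh) (A := A) i)
  refine Gens.ext (fun ⟨j, b⟩ => ?_) (fun ⟨j, b⟩ => ?_) fun ⟨j, b⟩ => ?_
  · change _ = PiTensorProduct.singleAlgHom j ((Function.update t i _ j).H b)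
    by_cases h : j = i
    · subst h
      rw [Function.update_self]
      refine Eq.trans ?_ (congrFun (congrArg Gens.H hs) b).symm
      simp only [Gens.braid, CartanDatum.sum_A_same]
      rfl
    · rw [Function.update_of_ne h]
      simp only [Gens.braid, CartanDatum.sum_A_ne D h]
      exact (congrArg _ (zero_zsmul _)).trans (sub_zero _)
  · change _ = PiTensorProduct.singleAlgHom j ((Function.update t i _ j).E b)
    by_cases h : j = i
    · subst h
      rw [Function.update_self]
      refine Eq.trans ?_ (congrFun (congrArg Gens.E hs) b).symm
      simp only [Gens.braid, CartanDatum.sum_A_same, Sigma.mk.injEq, true_and, heq_eq_eq]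
      rfl
    · rw [Function.update_of_ne h]
      simp only [Gens.braid, CartanDatum.sum_A_ne D (Ne.symm h),
        if_neg (fun e => h (congrArg Sigma.fst e) : ¬(⟨j, b⟩ : Σ i, ι i) = ⟨i, a⟩)]
      simp [qfact, qpow_zero, sumGens]
  · change _ = PiTensorProduct.singleAlgHom j ((Function.update t i _ j).F b)
    by_cases h : j = i
    · subst h
      rw [Function.update_self]
      refine Eq.trans ?_ (congrFun (congrArg Gens.F hs) b).symm
      simp only [Gens.braid, CartanDatum.sum_A_same, Sigma.mk.injEq, true_and, heq_eq_eq]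
      rfl
    · rw [Function.update_of_ne h]
      simp only [Gens.braid, CartanDatum.sum_A_ne D (Ne.symm h),
        if_neg (fun e => h (congrArg Sigma.fst e) : ¬(⟨j, b⟩ : Σ i, ι i) = ⟨i, a⟩)]
      simp [qfact, qpow_zero, sumGens]

theorem restrictWord_cons_same (i : Fin n) (a : ι i) (u : List (Σ i, ι i)) :
    restrictWord i (⟨i, a⟩ :: u) = a :: restrictWord i u := by
  simp [restrictWord]

theorem restrictWord_cons_ne {i j : Fin n} (h : i ≠ j) (a : ι i) (u : List (Σ i, ι i)) :
    restrictWord j (⟨i, a⟩ :: u) = restrictWord j u := by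
  simp [restrictWord, h]

/-- The root vectors of `g_1 ⊕ ⋯ ⊕ g_n` for the word `u` are a shuffle of those of the `g_i` for the
subwords of `u`, and root vectors from different blocks commute; so the product over the positive
roots factorizes. -/
theorem prod_rFactor_sumGens (N : ℕ) (u : List (Σ i, ι i)) (t : ∀ i, Gens (ι i) (A i)) :
    ((rootVectors (CartanDatum.sum D) N u (sumGens t)).map (rFactor N)).prod =
      interchange Kh A A (PiTensorProduct.tprod Kh fun i =>
        ((rootVectors (D i) N (restrictWord i u) (t i)).map (rFactor N)).prod) := by
  induction u generalizing t with
  | nil =>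
    symm
    exact map_one (interchange Kh A A)
  | cons p u ih =>
    obtain ⟨i, a⟩ := p
    rw [rootVectors, braid_sumGens, List.map_cons, List.prod_cons, ih]
    have e : (fun j => ((rootVectors (D j) N (restrictWord j (⟨i, a⟩ :: u)) (t j)).map
          (rFactor N)).prod) = Function.update (fun j => ((rootVectors (D j) N (restrictWord j u)
            (Function.update t i ((t i).braid (D i) N a) j)).map (rFactor N)).prod) i
        (rFactor N ((D i).d a, (t i).E a, (t i).F a) * ((rootVectors (D i) N (restrictWord i u)
            (Function.update t i ((t i).braid (D i) N a) i)).map (rFactor N)).prod) := by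
      funext j
      by_cases h : j = i
      · subst h
        rw [restrictWord_cons_same, Function.update_self, Function.update_self, rootVectors,
          List.map_cons, List.prod_cons]
      · rw [restrictWord_cons_ne (Ne.symm h), Function.update_of_ne h, Function.update_of_ne h]
    have e2 : rFactor N ((CartanDatum.sum D).d ⟨i, a⟩, (sumGens t).E ⟨i, a⟩,
        (sumGens t).F ⟨i, a⟩) = singleTmul Kh A A i
          (rFactor N ((D i).d a, (t i).E a, (t i).F a)) := by
      have e3 := map_qExp (C := A i ⊗[Kh] A i)
        (C' := (⨂[Kh] i, A i) ⊗[Kh] (⨂[Kh] i, A i)) (singleTmul Kh A A i) N ((D i).d a)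
        ((1 - qpow (-2 * (D i).d a)) • ((t i).E a ⊗ₜ[Kh] (t i).F a))
      rw [map_smul] at e3
      exact e3.symm
    rw [e, tprod_update_mul, map_mul, interchange_single, e2]

theorem sum_B_smul_sumGens (t : ∀ i, Gens (ι i) (A i)) :
    ∑ p, ∑ r, algebraMap ℚ Kh ((CartanDatum.sum D).B p r) •
        ((sumGens t).H p ⊗ₜ[Kh] (sumGens t).H r) =
      ∑ i, singleTmul Kh A A i
        (∑ a, ∑ b, algebraMap ℚ Kh ((D i).B a b) • ((t i).H a ⊗ₜ[Kh] (t i).H b)) := by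
  rw [Fintype.sum_sigma]
  refine Finset.sum_congr rfl fun i _ => ?_
  rw [map_sum]
  refine Finset.sum_congr rfl fun a _ => ?_
  rw [map_sum, Fintype.sum_sigma, Finset.sum_eq_single i]
  · refine Finset.sum_congr rfl fun b _ => ?_
    rw [map_smul, CartanDatum.sum_B, Matrix.blockDiagonal'_apply_eq]
    rfl
  · intro j _ hj
    refine Finset.sum_eq_zero fun b _ => ?_
    rw [CartanDatum.sum_B, Matrix.blockDiagonal'_apply_ne _ _ _ (Ne.symm hj), map_zero, zero_smul]
  · simp

/-- The universal `R`-matrix of `g_1 ⊕ ⋯ ⊕ g_n` is the product of those of the `g_i`, modulo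
`h ^ N`. -/
theorem rLevel_sumGens (hn : 0 < n) {N : ℕ}
    (hN : ∀ i, algebraMap Kh (A i) (PowerSeries.X ^ N) = 0) (u : List (Σ i, ι i))
    (t : ∀ i, Gens (ι i) (A i)) :
    rLevel (CartanDatum.sum D) u N (sumGens t) = interchange Kh A A
      (PiTensorProduct.tprod Kh fun i => rLevel (D i) (restrictWord i u) N (t i)) := by
  have : Nonempty (Fin n) := ⟨⟨0, hn⟩⟩
  simp only [rLevel]
  rw [prod_rFactor_sumGens, sum_B_smul_sumGens]
  have e := PiTensorProduct.tprod_mul_tprod (R := Kh)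
    (fun i => hexp N 1 (∑ a, ∑ b, algebraMap ℚ Kh ((D i).B a b) • ((t i).H a ⊗ₜ[Kh] (t i).H b)))
    (fun i => ((rootVectors (D i) N (restrictWord i u) (t i)).map (rFactor N)).prod)
  rw [Pi.mul_def] at e
  rw [← e, map_mul, tprod_hexp fun i => tensor_hN (hN i)]
  congr 1
  refine Eq.trans ?_ (map_hexp (C := ⨂[Kh] i, A i ⊗[Kh] A i)
    (C' := (⨂[Kh] i, A i) ⊗[Kh] (⨂[Kh] i, A i)) (interchange Kh A A) N 1 _).symm
  rw [map_sum]
  simp only [interchange_single]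

end sumGens

/-! ### The isomorphism of Drinfeld–Jimbo algebras -/

namespace UhLevel

/-- An element that commutes with the images of the generators commutes with the whole image. -/
theorem commute_of_gens {ι C : Type*} [Fintype ι] [Ring C] [Algebra Kh C] {D : CartanDatum ι}
    {N : ℕ} (f : UhLevel D N →ₐ[Kh] C) (c : C)
    (hH : ∀ i, Commute (f ((gens D N).H i)) c) (hE : ∀ i, Commute (f ((gens D N).E i)) c)
    (hF : ∀ i, Commute (f ((gens D N).F i)) c) (x : UhLevel D N) : Commute (f x) c := by
  obtain ⟨a, rfl⟩ := mk_surjective D N x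
  induction a using FreeAlgebra.induction with
  | grade0 r => rw [AlgHom.commutes, AlgHom.commutes]; exact Algebra.commute_algebraMap_left r c
  | grade1 g =>
    cases g with
    | H i => exact hH i
    | E i => exact hE i
    | F i => exact hF i
  | mul a b ha hb => rw [map_mul, map_mul]; exact ha.mul_left hb
  | add a b ha hb => rw [map_add, map_add]; exact ha.add_left hb

end UhLevel

section sumEquiv

variable {n : ℕ} {ι : Fin n → Type*} [∀ i, Fintype (ι i)] [∀ i, DecidableEq (ι i)]
  {D : ∀ i, CartanDatum (ι i)}

/-- The generators of the `i`-th block. -/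
def Gens.block {C : Type*} (t : Gens (Σ i, ι i) C) (i : Fin n) : Gens (ι i) C :=
  ⟨fun a => t.H ⟨i, a⟩, fun a => t.E ⟨i, a⟩, fun a => t.F ⟨i, a⟩⟩

section
variable {C : Type*} [Ring C] [Algebra Kh C] {N : ℕ} {t : Gens (Σ i, ι i) C}

theorem Sat.block (h : Sat (CartanDatum.sum D) N t) (i : Fin n) : Sat (D i) N (t.block i) := by
  have hne : ∀ {a b : ι i}, a ≠ b → (⟨i, a⟩ : Σ i, ι i) ≠ ⟨i, b⟩ := fun hab e =>
    hab (eq_of_heq (Sigma.mk.inj e).2)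
  intro x y hxy
  cases hxy with
  | HH a b => exact h _ _ (Rel.HH _ _)
  | HE a b => rw [← CartanDatum.sum_A_same D]; exact h _ _ (Rel.HE _ _)
  | HF a b => rw [← CartanDatum.sum_A_same D]; exact h _ _ (Rel.HF _ _)
  | EF a => exact h _ _ (Rel.EF _)
  | EF_ne a b hab => exact h _ _ (Rel.EF_ne _ _ (hne hab))
  | serreE a b hab => rw [← CartanDatum.sum_A_same D]; exact h _ _ (Rel.serreE _ _ (hne hab))
  | serreF a b hab => rw [← CartanDatum.sum_A_same D]; exact h _ _ (Rel.serreF _ _ (hne hab))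
  | hpow => exact h.hN

/-- Generators from different blocks commute; for two generators `E`, or two generators `F`, this is
the `q`-Serre relation of degree one. -/
theorem Sat.commute_block (h : Sat (CartanDatum.sum D) N t) {i j : Fin n} (hij : i ≠ j) (a : ι i)
    (b : ι j) {x y : C}
    (hx : x = (t.block i).H a ∨ x = (t.block i).E a ∨ x = (t.block i).F a)
    (hy : y = (t.block j).H b ∨ y = (t.block j).E b ∨ y = (t.block j).F b) : Commute x y := by
  have hne : (⟨i, a⟩ : Σ i, ι i) ≠ ⟨j, b⟩ := fun e => hij (congrArg Sigma.fst e)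
  have HE : ∀ p r, (CartanDatum.sum D).A p r = 0 → Commute (t.H p) (t.E r) := fun p r hA => by
    have := h _ _ (Rel.HE p r)
    rwa [hA, zero_smul, sub_eq_zero] at this
  have HF : ∀ p r, (CartanDatum.sum D).A p r = 0 → Commute (t.H p) (t.F r) := fun p r hA => by
    have := h _ _ (Rel.HF p r)
    rwa [hA, neg_zero, zero_smul, sub_eq_zero] at this
  have A1 : (CartanDatum.sum D).A ⟨i, a⟩ ⟨j, b⟩ = 0 := CartanDatum.sum_A_ne D hij a b
  have A2 : (CartanDatum.sum D).A ⟨j, b⟩ ⟨i, a⟩ = 0 := CartanDatum.sum_A_ne D hij.symm b a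
  rcases hx with rfl | rfl | rfl <;> rcases hy with rfl | rfl | rfl
  · exact sub_eq_zero.1 (h _ _ (Rel.HH _ _))
  · exact HE _ _ A1
  · exact HF _ _ A1
  · exact (HE _ _ A2).symm
  · have := h _ _ (Rel.serreE _ _ hne)
    rw [A1] at this
    exact sub_eq_zero.1 ((serre_one _ _ _).symm.trans this)
  · exact sub_eq_zero.1 (h _ _ (Rel.EF_ne _ _ hne))
  · exact (HF _ _ A2).symm
  · exact (sub_eq_zero.1 (h _ _ (Rel.EF_ne _ _ hne.symm))).symm
  · have := h _ _ (Rel.serreF _ _ hne)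
    rw [A1] at this
    exact sub_eq_zero.1 ((serre_one _ _ _).symm.trans this)

end

namespace UhLevel

variable (D) (hn : 0 < n) (N : ℕ)

/-- The homomorphism `U_h(g_i) → U_h(g_1 ⊕ ⋯ ⊕ g_n)` modulo `h ^ N`. -/
def blockHom (i : Fin n) : UhLevel (D i) N →ₐ[Kh] UhLevel (CartanDatum.sum D) N :=
  lift _ ((sat_gens (CartanDatum.sum D) N).block i)

theorem gens_map_blockHom (i : Fin n) :
    (gens (D i) N).map (blockHom D N i) = (gens (CartanDatum.sum D) N).block i :=
  map_lift _ _

theorem commute_blockHom : Pairwise fun i j => ∀ (x : UhLevel (D i) N) (y : UhLevel (D j) N),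
    Commute (blockHom D N i x) (blockHom D N j y) := by
  intro i j hij x y
  have hs := sat_gens (CartanDatum.sum D) N
  have H : ∀ i a, blockHom D N i ((gens (D i) N).H a) = _ := fun i a =>
    congrFun (congrArg Gens.H (gens_map_blockHom D N i)) a
  have E : ∀ i a, blockHom D N i ((gens (D i) N).E a) = _ := fun i a =>
    congrFun (congrArg Gens.E (gens_map_blockHom D N i)) a
  have F : ∀ i a, blockHom D N i ((gens (D i) N).F a) = _ := fun i a =>
    congrFun (congrArg Gens.F (gens_map_blockHom D N i)) a
  have key : ∀ a z, (z = ((gens (CartanDatum.sum D) N).block i).H a ∨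
      z = ((gens (CartanDatum.sum D) N).block i).E a ∨
      z = ((gens (CartanDatum.sum D) N).block i).F a) → Commute z (blockHom D N j y) := by
    intro a z hz
    refine (commute_of_gens _ z (fun b => ?_) (fun b => ?_) (fun b => ?_) y).symm
    · exact (hs.commute_block hij a b hz (Or.inl (H j b))).symm
    · exact (hs.commute_block hij a b hz (Or.inr (Or.inl (E j b)))).symm
    · exact (hs.commute_block hij a b hz (Or.inr (Or.inr (F j b)))).symm
  exact commute_of_gens _ _ (fun a => key a _ (Or.inl (H i a)))
    (fun a => key a _ (Or.inr (Or.inl (E i a)))) (fun a => key a _ (Or.inr (Or.inr (F i a)))) x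

/-- The homomorphism `U_h(g_1 ⊕ ⋯ ⊕ g_n) → U_h(g_1) ⊗ ⋯ ⊗ U_h(g_n)` modulo `h ^ N`. -/
def sumHom : UhLevel (CartanDatum.sum D) N →ₐ[Kh] ⨂[Kh] i, UhLevel (D i) N :=
  lift (sumGens fun i => gens (D i) N) (sat_sumGens D hn fun i => sat_gens (D i) N)

theorem gens_map_sumHom : (gens (CartanDatum.sum D) N).map (sumHom D hn N) =
    sumGens fun i => gens (D i) N :=
  map_lift _ _

/-- The homomorphism `U_h(g_1) ⊗ ⋯ ⊗ U_h(g_n) → U_h(g_1 ⊕ ⋯ ⊕ g_n)` modulo `h ^ N`. -/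
def sumInv : (⨂[Kh] i, UhLevel (D i) N) →ₐ[Kh] UhLevel (CartanDatum.sum D) N :=
  commLift (blockHom D N) (commute_blockHom D N)

theorem sumInv_single (i : Fin n) (x : UhLevel (D i) N) :
    sumInv D N (PiTensorProduct.singleAlgHom i x) = blockHom D N i x :=
  commLift_single (blockHom D N) (commute_blockHom D N) i x

theorem sumHom_blockHom (i : Fin n) (x : UhLevel (D i) N) :
    sumHom D hn N (blockHom D N i x) = PiTensorProduct.singleAlgHom i x := by
  have : (sumHom D hn N).comp (blockHom D N i) =
      PiTensorProduct.singleAlgHom (R := Kh) (A := fun i => UhLevel (D i) N) i := by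
    refine hom_ext ?_
    refine (congrArg (Gens.map (sumHom D hn N)) (gens_map_blockHom D N i)).trans ?_
    exact congrArg (fun t => Gens.block t i) (gens_map_sumHom D hn N)
  exact DFunLike.congr_fun this x

theorem sumHom_sumInv (x : ⨂[Kh] i, UhLevel (D i) N) : sumHom D hn N (sumInv D N x) = x := by
  have : (sumHom D hn N).comp (sumInv D N) = AlgHom.id Kh _ := by
    refine PiTensorProduct.algHom_ext fun i => AlgHom.ext fun x => ?_
    exact (congrArg (sumHom D hn N) (sumInv_single D N i x)).trans (sumHom_blockHom D hn N i x)
  exact DFunLike.congr_fun this x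

theorem sumInv_sumHom (x : UhLevel (CartanDatum.sum D) N) : sumInv D N (sumHom D hn N x) = x := by
  have : (sumInv D N).comp (sumHom D hn N) = AlgHom.id Kh _ := by
    refine hom_ext ?_
    refine (congrArg (Gens.map (sumInv D N)) (gens_map_sumHom D hn N)).trans ?_
    have e := gens_map_blockHom D N
    refine Gens.ext (fun p => ?_) (fun p => ?_) fun p => ?_
    · exact (sumInv_single D N _ _).trans (congrFun (congrArg Gens.H (e p.1)) p.2)
    · exact (sumInv_single D N _ _).trans (congrFun (congrArg Gens.E (e p.1)) p.2)
    · exact (sumInv_single D N _ _).trans (congrFun (congrArg Gens.F (e p.1)) p.2)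
  exact DFunLike.congr_fun this x

/-- The isomorphism `U_h(g_1 ⊕ ⋯ ⊕ g_n) ≃ U_h(g_1) ⊗ ⋯ ⊗ U_h(g_n)` modulo `h ^ N`. -/
def sumEquiv : UhLevel (CartanDatum.sum D) N ≃ₐ[Kh] ⨂[Kh] i, UhLevel (D i) N :=
  { sumHom D hn N with
    invFun := sumInv D N
    left_inv := sumInv_sumHom D hn N
    right_inv := sumHom_sumInv D hn N }

theorem gens_map_sumEquiv : (gens (CartanDatum.sum D) N).map (sumEquiv D hn N) =
    sumGens fun i => gens (D i) N := gens_map_sumHom D hn N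

theorem piTensorMap_single {κ : Type*} [DecidableEq κ] {A B : κ → Type*} [∀ i, Ring (A i)]
    [∀ i, Algebra Kh (A i)] [∀ i, Ring (B i)] [∀ i, Algebra Kh (B i)] (f : ∀ i, A i →ₐ[Kh] B i)
    (i : κ) (x : A i) : piTensorMap f (PiTensorProduct.singleAlgHom i x) =
      PiTensorProduct.singleAlgHom i (f i x) := by
  rw [PiTensorProduct.singleAlgHom_apply, PiTensorProduct.singleAlgHom_apply, piTensorMap_tprod]
  refine congrArg (PiTensorProduct.tprod Kh) (funext fun j => ?_)
  by_cases h : j = i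
  · subst h; simp
  · simp [h]

theorem map_sumGens {A B : Fin n → Type*} [∀ i, Ring (A i)]
    [∀ i, Algebra Kh (A i)] [∀ i, Ring (B i)] [∀ i, Algebra Kh (B i)] (f : ∀ i, A i →ₐ[Kh] B i)
    (t : ∀ i, Gens (ι i) (A i)) :
    (sumGens t).map (piTensorMap f) = sumGens fun i => (t i).map (f i) := by
  simp only [sumGens, Gens.map, piTensorMap_single]

theorem trans_sumEquiv (x : UhLevel (CartanDatum.sum D) (N + 1)) :
    piTensorMap (fun i => trans (D i) N) (sumEquiv D hn (N + 1) x) =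
      sumEquiv D hn N (trans (CartanDatum.sum D) N x) := by
  have : (piTensorMap fun i => trans (D i) N).comp (sumEquiv D hn (N + 1)).toAlgHom =
      (sumEquiv D hn N).toAlgHom.comp (trans (CartanDatum.sum D) N) := by
    refine hom_ext ?_
    refine (congrArg (Gens.map (piTensorMap fun i => trans (D i) N))
      (gens_map_sumEquiv D hn (N + 1))).trans ?_
    refine Eq.trans ?_ (congrArg (Gens.map (sumEquiv D hn N))
      (gens_map_trans (CartanDatum.sum D) N)).symm
    rw [map_sumGens, gens_map_sumEquiv]
    simp only [gens_map_trans]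
  exact DFunLike.congr_fun this x

end UhLevel

/-- Levelwise isomorphisms that are compatible with the transition maps induce an isomorphism of
the inverse limits. -/
def invLimCongr {A B : ℕ → Type*} [∀ N, Ring (A N)] [∀ N, Algebra Kh (A N)] [∀ N, Ring (B N)]
    [∀ N, Algebra Kh (B N)] {trA : ∀ N, A (N + 1) →ₐ[Kh] A N} {trB : ∀ N, B (N + 1) →ₐ[Kh] B N}
    (e : ∀ N, A N ≃ₐ[Kh] B N) (he : ∀ N x, trB N (e (N + 1) x) = e N (trA N x)) :
    invLim A trA ≃ₐ[Kh] invLim B trB where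
  toFun x := ⟨fun N => e N (x.1 N), fun N => by rw [he, x.2 N]⟩
  invFun y := ⟨fun N => (e N).symm (y.1 N), fun N => by
    rw [AlgEquiv.eq_symm_apply, ← he, AlgEquiv.apply_symm_apply, y.2 N]⟩
  left_inv x := Subtype.ext (funext fun N => (e N).symm_apply_apply _)
  right_inv y := Subtype.ext (funext fun N => (e N).apply_symm_apply _)
  map_mul' x y := Subtype.ext (funext fun N => map_mul (e N) _ _)
  map_add' x y := Subtype.ext (funext fun N => map_add (e N) _ _)
  commutes' r := Subtype.ext (funext fun N => (e N).commutes r)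

namespace Uh

variable (D) (hn : 0 < n)

/-- The isomorphism `U_h(g_1 ⊕ ⋯ ⊕ g_n) ≃ U_h(g_1) ⊗̂ ⋯ ⊗̂ U_h(g_n)`. -/
def sumEquiv : Uh (CartanDatum.sum D) ≃ₐ[Kh] UhTensor D :=
  invLimCongr (UhLevel.sumEquiv D hn) (UhLevel.trans_sumEquiv D hn)

theorem single_apply (i : Fin n) (x : Uh (D i)) (N : ℕ) :
    (UhTensor.single (D := D) i x).1 N = PiTensorProduct.singleAlgHom i (ev (D i) N x) := by
  rw [PiTensorProduct.singleAlgHom_apply]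
  refine congrArg (PiTensorProduct.tprod Kh) (funext fun j => ?_)
  by_cases h : j = i
  · subst h; simp
  · simp [h]

theorem isCanonicalIso_sumEquiv : IsCanonicalIso D (sumEquiv D hn) := by
  have key := UhLevel.gens_map_sumEquiv D hn
  refine ⟨fun i a => ?_, fun i a => ?_, fun i a => ?_⟩ <;>
    refine Subtype.ext (funext fun N => ?_) <;> rw [single_apply]
  · exact congrFun (congrArg Gens.H (key N)) ⟨i, a⟩
  · exact congrFun (congrArg Gens.E (key N)) ⟨i, a⟩
  · exact congrFun (congrArg Gens.F (key N)) ⟨i, a⟩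

end Uh

end sumEquiv

/-! ### Antipode and contractions of the `R`-matrix -/

section anti
variable {κ : Type*} [Fintype κ] [DecidableEq κ] {A : κ → Type*} [∀ i, Ring (A i)]
  [∀ i, Algebra Kh (A i)]

/-- The tensor product of anti-endomorphisms, written as a homomorphism to the opposite algebra. -/
def piTensorAnti (g : ∀ i, A i →ₐ[Kh] (A i)ᵐᵒᵖ) : (⨂[Kh] i, A i) →ₐ[Kh] (⨂[Kh] i, A i)ᵐᵒᵖ :=
  PiTensorProduct.liftAlgHom
    ((MulOpposite.opLinearEquiv Kh).toLinearMap.compMultilinearMap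
      ((PiTensorProduct.tprod Kh).compLinearMap fun i =>
        (MulOpposite.opLinearEquiv Kh).symm.toLinearMap ∘ₗ (g i).toLinearMap))
    (by
      refine congrArg (fun x => MulOpposite.op (PiTensorProduct.tprod Kh x)) (funext fun i => ?_)
      exact congrArg MulOpposite.unop (map_one (g i)))
    (fun x y => by
      refine Eq.trans ?_ (congrArg MulOpposite.op
        (PiTensorProduct.tprod_mul_tprod (R := Kh) (fun i => (g i (y i)).unop)
          fun i => (g i (x i)).unop).symm)
      refine congrArg (fun x => MulOpposite.op (PiTensorProduct.tprod Kh x)) (funext fun i => ?_)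
      exact congrArg MulOpposite.unop (map_mul (g i) (x i) (y i)))

theorem piTensorAnti_tprod (g : ∀ i, A i →ₐ[Kh] (A i)ᵐᵒᵖ) (x : ∀ i, A i) :
    piTensorAnti g (PiTensorProduct.tprod Kh x) =
      MulOpposite.op (PiTensorProduct.tprod Kh fun i => (g i (x i)).unop) :=
  PiTensorProduct.lift.tprod _

theorem piTensorAnti_single (g : ∀ i, A i →ₐ[Kh] (A i)ᵐᵒᵖ) (i : κ) (x : A i) :
    piTensorAnti g (PiTensorProduct.singleAlgHom i x) =
      MulOpposite.op (PiTensorProduct.singleAlgHom i (g i x).unop) := by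
  rw [PiTensorProduct.singleAlgHom_apply, PiTensorProduct.singleAlgHom_apply, piTensorAnti_tprod]
  refine congrArg (fun x => MulOpposite.op (PiTensorProduct.tprod Kh x)) (funext fun j => ?_)
  by_cases h : j = i
  · subst h; simp
  · simp [h]

end anti

theorem Gens.map_anti {ι C C' : Type*} [Fintype ι] [Ring C] [Algebra Kh C] [Ring C']
    [Algebra Kh C'] (D : CartanDatum ι) (N : ℕ) (t : Gens ι C) (f : C →ₐ[Kh] C') :
    (t.anti D N).map f.op = (t.map f).anti D N := by
  simp only [Gens.map, Gens.anti, Gens.mk.injEq, funext_iff]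
  refine ⟨fun i => ?_, fun i => ?_, fun i => ?_⟩ <;> simp [map_hexp]

section sumEquiv

variable {n : ℕ} {ι : Fin n → Type*} [∀ i, Fintype (ι i)] [∀ i, DecidableEq (ι i)]
  (D : ∀ i, CartanDatum (ι i)) (hn : 0 < n)

/-- A tensor product of antipodes acts on the generators by the formulas of the antipode. -/
theorem anti_sumGens {A : Fin n → Type*} [∀ i, Ring (A i)] [∀ i, Algebra Kh (A i)]
    (N : ℕ) (t : ∀ i, Gens (ι i) (A i)) (g : ∀ i, A i →ₐ[Kh] (A i)ᵐᵒᵖ)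
    (hg : ∀ i, (t i).map (g i) = (t i).anti (D i) N) :
    (sumGens t).map (piTensorAnti g) = (sumGens t).anti (CartanDatum.sum D) N := by
  refine Gens.ext (fun p => ?_) (fun p => ?_) fun p => ?_
  · have e := congrArg MulOpposite.unop (congrFun (congrArg Gens.H (hg p.1)) p.2)
    refine (piTensorAnti_single g p.1 _).trans (congrArg MulOpposite.op ?_)
    refine (congrArg _ e).trans ?_
    exact map_neg (PiTensorProduct.singleAlgHom (R := Kh) (A := A) p.1) _
  · have e := congrArg MulOpposite.unop (congrFun (congrArg Gens.E (hg p.1)) p.2)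
    refine (piTensorAnti_single g p.1 _).trans (congrArg MulOpposite.op ?_)
    refine (congrArg _ e).trans ?_
    refine (map_neg (PiTensorProduct.singleAlgHom (R := Kh) (A := A) p.1) _).trans ?_
    rw [map_mul, map_hexp]
    rfl
  · have e := congrArg MulOpposite.unop (congrFun (congrArg Gens.F (hg p.1)) p.2)
    refine (piTensorAnti_single g p.1 _).trans (congrArg MulOpposite.op ?_)
    refine (congrArg _ e).trans ?_
    refine (map_neg (PiTensorProduct.singleAlgHom (R := Kh) (A := A) p.1) _).trans ?_
    rw [map_mul, map_hexp]
    rfl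

namespace Uh

theorem sumEquiv_antipodeLevel (N : ℕ) (x : UhLevel (CartanDatum.sum D) N) :
    UhLevel.sumEquiv D hn N (antipodeLevel (CartanDatum.sum D) N x).unop =
      (piTensorAnti (fun i => antipodeLevel (D i) N) (UhLevel.sumEquiv D hn N x)).unop := by
  have : ((UhLevel.sumEquiv D hn N).toAlgHom.op).comp (antipodeLevel (CartanDatum.sum D) N) =
      (piTensorAnti fun i => antipodeLevel (D i) N).comp (UhLevel.sumEquiv D hn N).toAlgHom := by
    refine UhLevel.hom_ext ?_
    have h1 : (UhLevel.gens (CartanDatum.sum D) N).map (antipodeLevel (CartanDatum.sum D) N) =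
      (UhLevel.gens (CartanDatum.sum D) N).anti (CartanDatum.sum D) N := UhLevel.map_lift _ _
    have h2 := UhLevel.gens_map_sumEquiv D hn N
    have h3 : ∀ i, (UhLevel.gens (D i) N).map (antipodeLevel (D i) N) =
      (UhLevel.gens (D i) N).anti (D i) N := fun i => UhLevel.map_lift _ _
    refine (congrArg (Gens.map (UhLevel.sumEquiv D hn N).toAlgHom.op) h1).trans ?_
    refine Eq.trans ?_ (congrArg (Gens.map (piTensorAnti fun i => antipodeLevel (D i) N)) h2).symm
    rw [anti_sumGens D N _ _ h3, ← h2]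
    exact Gens.map_anti _ N _ (UhLevel.sumEquiv D hn N).toAlgHom
  exact congrArg MulOpposite.unop (DFunLike.congr_fun this x)

/-- The antipode of `U_h(g_1 ⊕ ⋯ ⊕ g_n)` is the tensor product of the antipodes. -/
theorem sumEquiv_antipode {x : Uh (CartanDatum.sum D)} {y : ∀ i, Uh (D i)}
    (h : sumEquiv D hn x = UhTensor.tprod y) :
    sumEquiv D hn (antipode (CartanDatum.sum D) x) =
      UhTensor.tprod fun i => antipode (D i) (y i) := by
  refine Subtype.ext (funext fun N => ?_)
  have hN := congrArg (fun z => z.1 N) h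
  refine (sumEquiv_antipodeLevel D hn N (ev _ N x)).trans ?_
  refine (congrArg (fun z => (piTensorAnti (fun i => antipodeLevel (D i) N) z).unop) hN).trans ?_
  exact congrArg MulOpposite.unop (piTensorAnti_tprod _ _)

/-- The tensor square of the isomorphism `UhLevel.sumEquiv`. -/
def sqHom (N : ℕ) : UhLevel (CartanDatum.sum D) N ⊗[Kh] UhLevel (CartanDatum.sum D) N →ₐ[Kh]
    (⨂[Kh] i, UhLevel (D i) N) ⊗[Kh] (⨂[Kh] i, UhLevel (D i) N) :=
  Algebra.TensorProduct.map (UhLevel.sumEquiv D hn N).toAlgHom (UhLevel.sumEquiv D hn N).toAlgHom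

/-- The element `X` of the completed tensor square for `g_1 ⊕ ⋯ ⊕ g_n` is the product of the
elements `R i` of the completed tensor squares for the `g_i`. -/
def IsProd (X : Sq (CartanDatum.sum D)) (R : ∀ i, Sq (D i)) : Prop :=
  ∀ N, sqHom D hn N (X.1 N) = interchange Kh (fun i => UhLevel (D i) N)
    (fun i => UhLevel (D i) N) (PiTensorProduct.tprod Kh fun i => (R i).1 N)

theorem isProd_universalR {w : ∀ i, List (ι i)} {u : List (Σ i, ι i)}
    (huw : ∀ i, restrictWord i u = w i) :
    IsProd D hn (universalR (CartanDatum.sum D) u).val fun i => (universalR (D i) (w i)).val := by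
  intro N
  obtain rfl : (fun i => restrictWord i u) = w := funext huw
  refine (map_rLevel (CartanDatum.sum D) u N (UhLevel.gens (CartanDatum.sum D) N)
    (UhLevel.sumEquiv D hn N).toAlgHom).trans ?_
  refine (congrArg (rLevel (CartanDatum.sum D) u N) (UhLevel.gens_map_sumEquiv D hn N)).trans ?_
  exact rLevel_sumGens D hn (fun i => (UhLevel.sat_gens (D i) N).hN) u _

/-- Passing to inverses is possible because `interchange` and `sqHom` are homomorphisms. -/
theorem IsProd.inv {X : (Sq (CartanDatum.sum D))ˣ} {R : ∀ i, (Sq (D i))ˣ}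
    (h : IsProd D hn X.val fun i => (R i).val) : IsProd D hn X.inv fun i => (R i).inv := by
  intro N
  have h1 : sqHom D hn N (X.inv.1 N) * sqHom D hn N (X.val.1 N) = 1 := by
    rw [← map_mul]
    exact (congrArg _ (congrFun (congrArg Subtype.val X.inv_val) N)).trans (map_one _)
  have h2 : (PiTensorProduct.tprod Kh fun i => (R i).val.1 N) *
      (PiTensorProduct.tprod Kh fun i => (R i).inv.1 N) = 1 := by
    rw [PiTensorProduct.tprod_mul_tprod, PiTensorProduct.one_def]
    exact congrArg (PiTensorProduct.tprod Kh)
      (funext fun i => congrFun (congrArg Subtype.val (R i).val_inv) N)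
  have h3 := congrArg (interchange Kh (fun i => UhLevel (D i) N) (fun i => UhLevel (D i) N)) h2
  rw [map_mul, map_one, ← h N] at h3
  exact left_inv_eq_right_inv h1 h3

section contract

variable {f : Uh (CartanDatum.sum D) →ₗ[Kh] Kh} {g : ∀ i, Uh (D i) →ₗ[Kh] Kh}

/-- If a functional `f` is the tensor product of functionals `g i`, then so are the bilinear maps
`(v, u) ↦ f(v) u` and `(v, u) ↦ g_i(v) u`. -/
theorem pairLevel_tprod
    (hf : ∀ v, f ((sumEquiv D hn).symm (UhTensor.tprod v)) = ∏ i, g i (v i))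
    (N : ℕ) (x y : ∀ i, UhLevel (D i) N) :
    UhLevel.sumEquiv D hn N (pairLevel f N
      ((UhLevel.sumEquiv D hn N).symm (PiTensorProduct.tprod Kh x))
      ((UhLevel.sumEquiv D hn N).symm (PiTensorProduct.tprod Kh y))) =
    PiTensorProduct.tprod Kh fun i => pairLevel (g i) N (x i) (y i) := by
  choose v hv using fun i => ev_surjective (D i) N (x i)
  obtain rfl : (fun i => ev (D i) N (v i)) = x := funext hv
  have e : (UhLevel.sumEquiv D hn N).symm (PiTensorProduct.tprod Kh fun i => ev (D i) N (v i)) =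
      ev _ N ((sumEquiv D hn).symm (UhTensor.tprod v)) := rfl
  rw [e, pairLevel_ev, hf, map_smul, AlgEquiv.apply_symm_apply]
  simp only [pairLevel_ev]
  exact ((PiTensorProduct.tprod Kh).map_smul_univ _ _).symm

/-- If a bilinear map on the tensor product of the `U_h(g_i)` is the tensor product of bilinear maps
`β i`, then it contracts a product of elements of tensor squares factor by factor. -/
theorem contract_of_isProd {N : ℕ}
    (β : ∀ i, UhLevel (D i) N →ₗ[Kh] UhLevel (D i) N →ₗ[Kh] UhLevel (D i) N)
    (γ : UhLevel (CartanDatum.sum D) N →ₗ[Kh] UhLevel (CartanDatum.sum D) N →ₗ[Kh]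
      UhLevel (CartanDatum.sum D) N)
    (h : ∀ x y : ∀ i, UhLevel (D i) N, UhLevel.sumEquiv D hn N
      (γ ((UhLevel.sumEquiv D hn N).symm (PiTensorProduct.tprod Kh x))
        ((UhLevel.sumEquiv D hn N).symm (PiTensorProduct.tprod Kh y))) =
      PiTensorProduct.tprod Kh fun i => β i (x i) (y i))
    {X : UhLevel (CartanDatum.sum D) N ⊗[Kh] UhLevel (CartanDatum.sum D) N}
    {R : ∀ i, UhLevel (D i) N ⊗[Kh] UhLevel (D i) N}
    (hX : sqHom D hn N X = interchange Kh (fun i => UhLevel (D i) N)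
      (fun i => UhLevel (D i) N) (PiTensorProduct.tprod Kh R)) :
    UhLevel.sumEquiv D hn N (TensorProduct.lift γ X) =
      PiTensorProduct.tprod Kh fun i => TensorProduct.lift (β i) (R i) := by
  let e := UhLevel.sumEquiv D hn N
  let L : (⨂[Kh] i, UhLevel (D i) N) ⊗[Kh] (⨂[Kh] i, UhLevel (D i) N) →ₗ[Kh]
      ⨂[Kh] i, UhLevel (D i) N :=
    e.toLinearMap ∘ₗ TensorProduct.lift γ ∘ₗ
      TensorProduct.map e.symm.toLinearMap e.symm.toLinearMap
  have hL : L (sqHom D hn N X) = e (TensorProduct.lift γ X) := by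
    have : L ∘ₗ (sqHom D hn N).toLinearMap = e.toLinearMap ∘ₗ TensorProduct.lift γ := by
      refine TensorProduct.ext' fun a b => ?_
      change e (γ (e.symm (e a)) (e.symm (e b))) = e (γ a b)
      rw [e.symm_apply_apply, e.symm_apply_apply]
    exact DFunLike.congr_fun this X
  let M : MultilinearMap Kh (fun i => UhLevel (D i) N ⊗[Kh] UhLevel (D i) N)
      (⨂[Kh] i, UhLevel (D i) N) :=
    (L ∘ₗ (interchange Kh (fun i => UhLevel (D i) N)
      (fun i => UhLevel (D i) N)).toLinearMap).compMultilinearMap (PiTensorProduct.tprod Kh)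
  let M' : MultilinearMap Kh (fun i => UhLevel (D i) N ⊗[Kh] UhLevel (D i) N)
      (⨂[Kh] i, UhLevel (D i) N) :=
    (PiTensorProduct.tprod Kh).compLinearMap fun i => TensorProduct.lift (β i)
  have hM : M = M' := by
    refine multilinear_ext_tmul fun a b => ?_
    refine (congrArg L (interchange_tprod a b)).trans ?_
    exact h a b
  refine hL.symm.trans ((congrArg L hX).trans ?_)
  exact DFunLike.congr_fun hM R

theorem contractLeft_of_isProd {X : Sq (CartanDatum.sum D)} {R : ∀ i, Sq (D i)}
    (hf : ∀ v, f ((sumEquiv D hn).symm (UhTensor.tprod v)) = ∏ i, g i (v i))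
    (hX : IsProd D hn X R) :
    sumEquiv D hn (contractLeft f X) = UhTensor.tprod fun i => contractLeft (g i) (R i) :=
  Subtype.ext (funext fun N => contract_of_isProd D hn (fun i => pairLevel (g i) N)
    (pairLevel f N) (pairLevel_tprod D hn hf N) (hX N))

theorem contractRight_of_isProd {X : Sq (CartanDatum.sum D)} {R : ∀ i, Sq (D i)}
    (hf : ∀ v, f ((sumEquiv D hn).symm (UhTensor.tprod v)) = ∏ i, g i (v i))
    (hX : IsProd D hn X R) :
    sumEquiv D hn (contractRight f X) = UhTensor.tprod fun i => contractRight (g i) (R i) :=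
  Subtype.ext (funext fun N => contract_of_isProd D hn (fun i => (pairLevel (g i) N).flip)
    (pairLevel f N).flip (fun x y => pairLevel_tprod D hn hf N y x) (hX N))

end contract
end Uh
end sumEquiv

/-! ### Completeness and the tensor product representation -/

/-- A `ℂ[[h]]`-module is `h`-adically separated and complete. -/
structure IsHComplete (M : Type*) [AddCommGroup M] [Module Kh M] : Prop where
  separated : ∀ x : M, (∀ N, ∃ y : M, x = (PowerSeries.X ^ N : Kh) • y) → x = 0
  complete : ∀ m : ℕ → M, (∀ N, ∃ y : M, m (N + 1) - m N = (PowerSeries.X ^ N : Kh) • y) →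
    ∃ l : M, ∀ N, ∃ y : M, l - m N = (PowerSeries.X ^ N : Kh) • y

theorem isHComplete_powerSeries : IsHComplete Kh where
  separated x hx := by
    ext k
    obtain ⟨y, rfl⟩ := hx (k + 1)
    rw [smul_eq_mul, map_zero, PowerSeries.coeff_X_pow_mul', if_neg (by omega)]
  complete m hm := by
    have hc : ∀ k N, k < N → PowerSeries.coeff k (m N) = PowerSeries.coeff k (m (k + 1)) := by
      intro k N hN
      induction N, hN using Nat.le_induction with
      | base => rfl
      | succ N hN ih =>
        obtain ⟨y, hy⟩ := hm N
        rw [← ih, ← sub_eq_zero, ← map_sub, hy, smul_eq_mul, PowerSeries.coeff_X_pow_mul',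
          if_neg (by omega)]
    -- The coefficient of `h ^ k` is constant in the sequence from the term `k + 1` on.
    refine ⟨PowerSeries.mk fun k => PowerSeries.coeff k (m (k + 1)), fun N => ?_⟩
    have : (PowerSeries.X ^ N : Kh) ∣
        (PowerSeries.mk fun k => PowerSeries.coeff k (m (k + 1))) - m N := by
      rw [PowerSeries.X_pow_dvd_iff]
      intro k hk
      rw [map_sub, PowerSeries.coeff_mk, hc k N hk, sub_self]
    exact this

theorem isHComplete_of_free (M : Type*) [AddCommGroup M] [Module Kh M] [Module.Free Kh M]
    [Module.Finite Kh M] : IsHComplete M := by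
  let b := Module.finBasis Kh M
  have hK := isHComplete_powerSeries
  refine ⟨fun x hx => ?_, fun m hm => ?_⟩
  · refine b.ext_elem fun i => ?_
    rw [map_zero]
    refine hK.separated _ fun N => ?_
    obtain ⟨y, rfl⟩ := hx N
    exact ⟨b.repr y i, by simp⟩
  · have h1 : ∀ i, ∃ l : Kh, ∀ N, ∃ y : Kh, l - b.repr (m N) i = (PowerSeries.X ^ N : Kh) • y :=
      fun i => hK.complete (fun N => b.repr (m N) i) fun N => by
        obtain ⟨y, hy⟩ := hm N
        refine ⟨b.repr y i, ?_⟩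
        have := congrArg (fun z => b.repr z i) hy
        simpa using this
    choose l y hl using h1
    refine ⟨∑ i, l i • b i, fun N => ⟨∑ i, y i N • b i, ?_⟩⟩
    conv_lhs => rw [← b.sum_repr (m N)]
    rw [← Finset.sum_sub_distrib, Finset.smul_sum]
    refine Finset.sum_congr rfl fun i _ => ?_
    rw [← sub_smul, hl, smul_assoc]

/-- A homomorphism that vanishes on the kernel of a surjective homomorphism descends. -/
def surjLift {A B C : Type*} [Ring A] [Algebra Kh A] [Ring B] [Algebra Kh B] [Ring C]
    [Algebra Kh C] (f : A →ₐ[Kh] B) (hf : Function.Surjective f) (g : A →ₐ[Kh] C)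
    (h : ∀ x, f x = 0 → g x = 0) : B →ₐ[Kh] C :=
  have key : ∀ {x y : A}, f x = f y → g x = g y := fun {x y} e => by
    rw [← sub_eq_zero, ← map_sub]
    exact h _ (by rw [map_sub, e, sub_self])
  { toFun := fun b => g (Function.surjInv hf b)
    map_one' := (key (by rw [Function.surjInv_eq hf, map_one])).trans (map_one g)
    map_zero' := (key (by rw [Function.surjInv_eq hf, map_zero])).trans (map_zero g)
    map_mul' := fun x y => (key (by
      rw [Function.surjInv_eq hf, map_mul, Function.surjInv_eq hf, Function.surjInv_eq hf])).trans
        (map_mul g _ _)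
    map_add' := fun x y => (key (by
      rw [Function.surjInv_eq hf, map_add, Function.surjInv_eq hf, Function.surjInv_eq hf])).trans
        (map_add g _ _)
    commutes' := fun r => (key (by rw [Function.surjInv_eq hf, AlgHom.commutes])).trans
      (g.commutes r) }

theorem surjLift_apply {A B C : Type*} [Ring A] [Algebra Kh A] [Ring B] [Algebra Kh B] [Ring C]
    [Algebra Kh C] (f : A →ₐ[Kh] B) (hf : Function.Surjective f) (g : A →ₐ[Kh] C)
    (h : ∀ x, f x = 0 → g x = 0) (x : A) : surjLift f hf g h (f x) = g x := by
  have e : f (Function.surjInv hf (f x) - x) = 0 := by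
    rw [map_sub, Function.surjInv_eq hf, sub_self]
  exact sub_eq_zero.1 ((map_sub g _ _).symm.trans (h _ e))

section quotient
variable (M : Type*) [Ring M] [Algebra Kh M] (N : ℕ)

/-- The two-sided ideal `h ^ N M`. -/
def hIdeal : Ideal M := Ideal.span {algebraMap Kh M (PowerSeries.X ^ N)}

theorem mem_hIdeal {x : M} : x ∈ hIdeal M N ↔ ∃ y : M, x = (PowerSeries.X ^ N : Kh) • y := by
  rw [hIdeal, Ideal.mem_span_singleton']
  refine exists_congr fun y => ?_
  rw [← Algebra.commutes, ← Algebra.smul_def, eq_comm]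

instance : (hIdeal M N).IsTwoSided := ⟨fun b h => by
  obtain ⟨y, rfl⟩ := (mem_hIdeal M N).1 h
  exact (mem_hIdeal M N).2 ⟨y * b, smul_mul_assoc _ _ _⟩⟩

/-- The projection `M → M / h ^ N M`. -/
def hProj : M →ₐ[Kh] M ⧸ hIdeal M N := Ideal.Quotient.mkₐ Kh (hIdeal M N)

theorem hProj_surjective : Function.Surjective (hProj M N) := Ideal.Quotient.mkₐ_surjective _ _

theorem hProj_eq_zero {x : M} : hProj M N x = 0 ↔ ∃ y : M, x = (PowerSeries.X ^ N : Kh) • y :=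
  Ideal.Quotient.eq_zero_iff_mem.trans (mem_hIdeal M N)

theorem hProj_eq {x y : M} :
    hProj M N x = hProj M N y ↔ ∃ z : M, x - y = (PowerSeries.X ^ N : Kh) • z := by
  rw [← hProj_eq_zero, map_sub, sub_eq_zero]

/-- The projection `M / h ^ (N + 1) M → M / h ^ N M`. -/
def hTrans : M ⧸ hIdeal M (N + 1) →ₐ[Kh] M ⧸ hIdeal M N :=
  surjLift (hProj M (N + 1)) (hProj_surjective M _) (hProj M N) fun x hx => by
    obtain ⟨y, rfl⟩ := (hProj_eq_zero M _).1 hx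
    exact (hProj_eq_zero M _).2 ⟨(PowerSeries.X : Kh) • y, by rw [smul_smul, pow_succ]⟩

theorem hTrans_hProj (x : M) : hTrans M N (hProj M (N + 1) x) = hProj M N x :=
  surjLift_apply _ _ _ _ x

end quotient

section lift
variable {M : Type*} [Ring M] [Algebra Kh M] {A : ℕ → Type*} [∀ N, Ring (A N)]
  [∀ N, Algebra Kh (A N)] {tr : ∀ N, A (N + 1) →ₐ[Kh] A N}

theorem IsHComplete.ext (hM : IsHComplete M) {x y : M} (h : ∀ N, hProj M N x = hProj M N y) :
    x = y :=
  sub_eq_zero.1 (hM.separated _ fun N => (hProj_eq M N).1 (h N))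

theorem IsHComplete.exists_lift (hM : IsHComplete M) (g : ∀ N, A N →ₐ[Kh] M ⧸ hIdeal M N)
    (hg : ∀ N x, hTrans M N (g (N + 1) x) = g N (tr N x)) (x : invLim A tr) :
    ∃ m, ∀ N, hProj M N m = g N (x.1 N) := by
  choose m hm using fun N => hProj_surjective M N (g N (x.1 N))
  obtain ⟨l, hl⟩ := hM.complete m fun N => (hProj_eq M N).1 (by
    rw [← hTrans_hProj, hm, hg, x.2 N, hm])
  exact ⟨l, fun N => ((hProj_eq M N).2 (hl N)).trans (hm N)⟩

/-- The homomorphism to an `h`-adically complete algebra `M` given by compatible homomorphisms to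
the quotients `M / h ^ N M`. -/
def IsHComplete.lift (hM : IsHComplete M) (g : ∀ N, A N →ₐ[Kh] M ⧸ hIdeal M N)
    (hg : ∀ N x, hTrans M N (g (N + 1) x) = g N (tr N x)) : invLim A tr →ₐ[Kh] M :=
  have hs := fun x => (hM.exists_lift g hg x).choose_spec
  { toFun := fun x => (hM.exists_lift g hg x).choose
    map_one' := hM.ext fun N => by rw [hs, map_one]; exact map_one (g N)
    map_zero' := hM.ext fun N => by rw [hs, map_zero]; exact map_zero (g N)
    map_mul' := fun x y => hM.ext fun N => by
      rw [hs, map_mul, hs, hs]; exact map_mul (g N) _ _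
    map_add' := fun x y => hM.ext fun N => by
      rw [hs, map_add, hs, hs]; exact map_add (g N) _ _
    commutes' := fun r => hM.ext fun N => by
      rw [hs, AlgHom.commutes]; exact (g N).commutes r }

theorem IsHComplete.hProj_lift (hM : IsHComplete M) (g : ∀ N, A N →ₐ[Kh] M ⧸ hIdeal M N)
    (hg : ∀ N x, hTrans M N (g (N + 1) x) = g N (tr N x)) (x : invLim A tr) (N : ℕ) :
    hProj M N (hM.lift g hg x) = g N (x.1 N) :=
  (hM.exists_lift g hg x).choose_spec N

end lift

section rep

/-- The action of `⨂ End V_i` on `⨂ V_i`. -/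
def piTensorEnd {κ : Type*} (V : κ → Type*) [∀ i, AddCommGroup (V i)] [∀ i, Module Kh (V i)] :
    (⨂[Kh] i, Module.End Kh (V i)) →ₐ[Kh] Module.End Kh (⨂[Kh] i, V i) :=
  PiTensorProduct.liftAlgHom (PiTensorProduct.mapMultilinear Kh V V) PiTensorProduct.map_one
    fun x y => PiTensorProduct.map_mul x y

theorem piTensorEnd_tprod {κ : Type*} (V : κ → Type*) [∀ i, AddCommGroup (V i)]
    [∀ i, Module Kh (V i)] (f : ∀ i, Module.End Kh (V i)) :
    piTensorEnd V (PiTensorProduct.tprod Kh f) = PiTensorProduct.map f :=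
  PiTensorProduct.lift.tprod _

variable {n : ℕ} {ι : Fin n → Type*} [∀ i, Fintype (ι i)] [∀ i, DecidableEq (ι i)]
  {D : ∀ i, CartanDatum (ι i)} (hn : 0 < n) {V : Fin n → Type*} [∀ i, AddCommGroup (V i)]
  [∀ i, Module Kh (V i)] (T : ∀ i, Uh (D i) →ₐ[Kh] Module.End Kh (V i)) (N : ℕ)

/-- The action of the `i`-th tensor factor on `V_1 ⊗ ⋯ ⊗ V_n`. -/
def factorRep (i : Fin n) : Uh (D i) →ₐ[Kh] Module.End Kh (⨂[Kh] i, V i) :=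
  ((piTensorEnd V).comp (PiTensorProduct.singleAlgHom i)).comp (T i)

/-- The action of the `i`-th tensor factor on `V_1 ⊗ ⋯ ⊗ V_n`, modulo `h ^ N`. -/
def factorRepLevel (i : Fin n) : UhLevel (D i) N →ₐ[Kh]
    Module.End Kh (⨂[Kh] i, V i) ⧸ hIdeal (Module.End Kh (⨂[Kh] i, V i)) N :=
  surjLift (Uh.ev (D i) N) (Uh.ev_surjective (D i) N) ((hProj _ N).comp (factorRep T i))
    fun x hx => by
      obtain ⟨y, rfl⟩ := Uh.ker_ev (D i) N x hx
      exact (hProj_eq_zero _ N).2 ⟨factorRep T i y, map_smul (factorRep T i) _ y⟩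

theorem factorRepLevel_ev (i : Fin n) (x : Uh (D i)) :
    factorRepLevel T N i (Uh.ev (D i) N x) = hProj _ N (factorRep T i x) :=
  surjLift_apply _ _ _ _ x

theorem commute_factorRep {i j : Fin n} (hij : i ≠ j) (x : Uh (D i)) (y : Uh (D j)) :
    Commute (factorRep T i x) (factorRep T j y) := by
  have h := congrArg (piTensorEnd V)
    (commute_single (R := Kh) (A := fun i => Module.End Kh (V i)) hij (T i x) (T j y)).eq
  rw [map_mul, map_mul] at h
  exact h

theorem commute_factorRepLevel : Pairwise fun i j => ∀ (x : UhLevel (D i) N) (y : UhLevel (D j) N),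
    Commute (factorRepLevel T N i x) (factorRepLevel T N j y) := by
  intro i j hij x y
  obtain ⟨x, rfl⟩ := Uh.ev_surjective (D i) N x
  obtain ⟨y, rfl⟩ := Uh.ev_surjective (D j) N y
  rw [factorRepLevel_ev, factorRepLevel_ev]
  have h := congrArg (hProj (Module.End Kh (⨂[Kh] i, V i)) N) (commute_factorRep T hij x y).eq
  rw [map_mul, map_mul] at h
  exact h

/-- The action of `⨂ U_h(g_i)` on `V_1 ⊗ ⋯ ⊗ V_n`, modulo `h ^ N`. -/
def tensorRepLevel : (⨂[Kh] i, UhLevel (D i) N) →ₐ[Kh]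
    Module.End Kh (⨂[Kh] i, V i) ⧸ hIdeal (Module.End Kh (⨂[Kh] i, V i)) N :=
  commLift (factorRepLevel T N) (commute_factorRepLevel T N)

theorem tensorRepLevel_single (i : Fin n) (x : UhLevel (D i) N) :
    tensorRepLevel T N (PiTensorProduct.singleAlgHom i x) = factorRepLevel T N i x :=
  commLift_single (factorRepLevel T N) (commute_factorRepLevel T N) i x

theorem tensorRepLevel_tprod (x : ∀ i, Uh (D i)) :
    tensorRepLevel T N (PiTensorProduct.tprod Kh fun i => Uh.ev (D i) N (x i)) =
      hProj _ N (PiTensorProduct.map fun i => T i (x i)) := by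
  let p : (∀ i, Uh (D i)) →* ⨂[Kh] i, UhLevel (D i) N :=
    (PiTensorProduct.tprodMonoidHom Kh).comp
      (MonoidHom.pi fun i => (Uh.ev (D i) N).toRingHom.toMonoidHom.comp (Pi.evalMonoidHom _ i))
  let q : (∀ i, Uh (D i)) →* Module.End Kh (⨂[Kh] i, V i) :=
    PiTensorProduct.mapMonoidHom.comp
      (MonoidHom.pi fun i => (T i).toRingHom.toMonoidHom.comp (Pi.evalMonoidHom _ i))
  have : (tensorRepLevel T N).toRingHom.toMonoidHom.comp p =
      (hProj (Module.End Kh (⨂[Kh] i, V i)) N).toRingHom.toMonoidHom.comp q := by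
    refine MonoidHom.pi_ext fun i y => ?_
    have e1 : p (Pi.mulSingle i y) = PiTensorProduct.singleAlgHom i (Uh.ev (D i) N y) := by
      rw [PiTensorProduct.singleAlgHom_apply]
      refine congrArg (PiTensorProduct.tprod Kh) (funext fun j => ?_)
      change Uh.ev (D j) N (Pi.mulSingle (M := fun i => Uh (D i)) i y j) = _
      by_cases h : j = i
      · subst h; simp
      · simp [h]
    have e2 : q (Pi.mulSingle i y) = factorRep T i y := by
      refine Eq.trans ?_ (piTensorEnd_tprod V _).symm
      refine congrArg PiTensorProduct.map (funext fun j => ?_)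
      change T j (Pi.mulSingle (M := fun i => Uh (D i)) i y j) = _
      by_cases h : j = i
      · subst h; simp
      · simp [h]
    exact (congrArg (tensorRepLevel T N) e1).trans ((tensorRepLevel_single T N i _).trans
      ((factorRepLevel_ev T N i y).trans (congrArg (hProj _ N) e2.symm)))
  exact DFunLike.congr_fun this x

theorem hTrans_tensorRepLevel (x : ⨂[Kh] i, UhLevel (D i) (N + 1)) :
    hTrans _ N (tensorRepLevel T (N + 1) x) =
      tensorRepLevel T N (piTensorMap (fun i => UhLevel.trans (D i) N) x) := by
  have : (hTrans _ N).comp (tensorRepLevel T (N + 1)) =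
      (tensorRepLevel T N).comp (piTensorMap fun i => UhLevel.trans (D i) N) := by
    refine PiTensorProduct.algHom_ext fun i => AlgHom.ext fun y => ?_
    obtain ⟨y, rfl⟩ := Uh.ev_surjective (D i) (N + 1) y
    refine (congrArg (hTrans _ N) ((tensorRepLevel_single T (N + 1) i _).trans
      (factorRepLevel_ev T (N + 1) i y))).trans ?_
    refine (hTrans_hProj _ N _).trans ?_
    refine Eq.trans ?_ (congrArg (tensorRepLevel T N)
      (UhLevel.piTensorMap_single (fun i => UhLevel.trans (D i) N) i _)).symm
    rw [Uh.trans_ev, tensorRepLevel_single, factorRepLevel_ev]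
  exact DFunLike.congr_fun this x

theorem exists_isTensorRep (hM : IsHComplete (Module.End Kh (⨂[Kh] i, V i)))
    (Φ : Uh (CartanDatum.sum D) ≃ₐ[Kh] UhTensor D) : ∃ S, IsTensorRep D Φ T S := by
  refine ⟨(hM.lift (tensorRepLevel T) fun N => hTrans_tensorRepLevel T N).comp Φ.toAlgHom,
    fun u v => ?_⟩
  have : hM.lift (tensorRepLevel T) (fun N => hTrans_tensorRepLevel T N) (UhTensor.tprod u) =
      PiTensorProduct.map fun i => T i (u i) :=
    hM.ext fun N => (hM.hProj_lift _ _ _ N).trans (tensorRepLevel_tprod T N u)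
  refine (congrArg (fun x => hM.lift (tensorRepLevel T) (fun N => hTrans_tensorRepLevel T N) x
    (PiTensorProduct.tprod Kh v)) (Φ.apply_symm_apply (UhTensor.tprod u))).trans ?_
  rw [this, PiTensorProduct.map_tprod]

/-- Modulo `h ^ N` every element is a sum of pure tensors, on which the action is prescribed, and
`End (⨂ V_i)` is `h`-adically separated. -/
theorem IsTensorRep.unique (hM : IsHComplete (Module.End Kh (⨂[Kh] i, V i)))
    {S S' : Uh (CartanDatum.sum D) →ₐ[Kh] Module.End Kh (⨂[Kh] i, V i)}
    (h : IsTensorRep D (Uh.sumEquiv D hn) T S) (h' : IsTensorRep D (Uh.sumEquiv D hn) T S') :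
    S = S' := by
  have key : ∀ N (t : ⨂[Kh] i, UhLevel (D i) N), ∃ z, Uh.ev (CartanDatum.sum D) N z =
      (UhLevel.sumEquiv D hn N).symm t ∧ S z = S' z := by
    intro N t
    induction t using PiTensorProduct.induction_on with
    | smul_tprod r x =>
      choose u hu using fun i => Uh.ev_surjective (D i) N (x i)
      obtain rfl : (fun i => Uh.ev (D i) N (u i)) = x := funext hu
      refine ⟨r • (Uh.sumEquiv D hn).symm (UhTensor.tprod u), ?_, ?_⟩
      · rw [map_smul, map_smul]; rfl
      · rw [map_smul, map_smul]
        refine congrArg (r • ·) (PiTensorProduct.ext (MultilinearMap.ext fun v => ?_))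
        exact (h u v).trans (h' u v).symm
    | add x y hx hy =>
      obtain ⟨z, h1, h2⟩ := hx
      obtain ⟨z', h1', h2'⟩ := hy
      exact ⟨z + z', by rw [map_add, h1, h1', map_add], by rw [map_add, h2, h2', map_add]⟩
  refine AlgHom.ext fun x => hM.ext fun N => (hProj_eq _ N).2 ?_
  obtain ⟨z, h1, h2⟩ := key N (UhLevel.sumEquiv D hn N (Uh.ev _ N x))
  rw [AlgEquiv.symm_apply_apply] at h1
  obtain ⟨y, hy⟩ := Uh.ker_ev (CartanDatum.sum D) N (x - z) (by rw [map_sub, h1, sub_self])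
  refine ⟨S y - S' y, ?_⟩
  have e1 := congrArg S hy
  have e2 := congrArg S' hy
  rw [map_sub, map_smul] at e1 e2
  refine Eq.trans ?_ ((congrArg₂ (· - ·) e1 e2).trans
    (smul_sub (PowerSeries.X ^ N : Kh) (S y) (S' y)).symm)
  rw [h2, sub_sub_sub_cancel_right]

end rep

/-! ### FRT generators of the tensor product representation -/

/-- Base change of a homomorphism to `ℂ((h))` respects the `K`-subalgebras generated by images. -/
theorem image_adjoinField (K : Subfield (LaurentSeries ℂ)) {A B : Type*} [Ring A] [Algebra Kh A]
    [Ring B] [Algebra Kh B] (f : A →ₐ[Kh] B) (G : Set A) :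
    Algebra.TensorProduct.map (AlgHom.id (LaurentSeries ℂ) (LaurentSeries ℂ)) f ''
      (adjoinField K G : Set (LaurentSeries ℂ ⊗[Kh] A)) =
    (adjoinField K (f '' G) : Set (LaurentSeries ℂ ⊗[Kh] B)) := by
  have h := AlgHom.map_adjoin ((Algebra.TensorProduct.map
    (AlgHom.id (LaurentSeries ℂ) (LaurentSeries ℂ)) f).restrictScalars K)
    ((fun x => 1 ⊗ₜ[Kh] x) '' G)
  refine (congrArg SetLike.coe h).trans ?_
  rw [adjoinField, Set.image_image, Set.image_image]
  rfl

section frt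

variable {n : ℕ} {ι : Fin n → Type*} [∀ i, Fintype (ι i)] [∀ i, DecidableEq (ι i)]
  {D : ∀ i, CartanDatum (ι i)} (hn : 0 < n) {V : Fin n → Type*} [∀ i, AddCommGroup (V i)]
  [∀ i, Module Kh (V i)] {T : ∀ i, Uh (D i) →ₐ[Kh] Module.End Kh (V i)}
  {S : Uh (CartanDatum.sum D) →ₐ[Kh] Module.End Kh (⨂[Kh] i, V i)}
  {κ : Fin n → Type*} (b : ∀ i, Module.Basis (κ i) Kh (V i))
  {w : ∀ i, List (ι i)} {u : List (Σ i, ι i)}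

theorem IsTensorRep.matrixCoeff {Φ : Uh (CartanDatum.sum D) ≃ₐ[Kh] UhTensor D}
    (h : IsTensorRep D Φ T S) (k j : ∀ i, κ i) (v : ∀ i, Uh (D i)) :
    QG.matrixCoeff S (Basis.piTensorProduct b) k j (Φ.symm (UhTensor.tprod v)) =
      ∏ i, QG.matrixCoeff (T i) (b i) (k i) (j i) (v i) := by
  change (Basis.piTensorProduct b).repr (S (Φ.symm (UhTensor.tprod v))
    (Basis.piTensorProduct b j)) k = _
  rw [Basis.piTensorProduct_apply, h, Basis.piTensorProduct_repr_tprod_apply]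
  rfl

theorem IsTensorRep.mPlus (h : IsTensorRep D (Uh.sumEquiv D hn) T S)
    (huw : ∀ i, restrictWord i u = w i) (k j : ∀ i, κ i) :
    Uh.sumEquiv D hn (QG.mPlus (CartanDatum.sum D) u S (Basis.piTensorProduct b) k j) =
      UhTensor.tprod fun i => QG.mPlus (D i) (w i) (T i) (b i) (k i) (j i) :=
  Uh.sumEquiv_antipode D hn (Uh.contractRight_of_isProd D hn (h.matrixCoeff b k j)
    (Uh.isProd_universalR D hn huw))

theorem IsTensorRep.mMinus (h : IsTensorRep D (Uh.sumEquiv D hn) T S)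
    (huw : ∀ i, restrictWord i u = w i) (k j : ∀ i, κ i) :
    Uh.sumEquiv D hn (QG.mMinus (CartanDatum.sum D) u S (Basis.piTensorProduct b) k j) =
      UhTensor.tprod fun i => QG.mMinus (D i) (w i) (T i) (b i) (k i) (j i) :=
  Uh.sumEquiv_antipode D hn (Uh.contractLeft_of_isProd D hn (h.matrixCoeff b k j)
    (Uh.isProd_universalR D hn huw).inv)

theorem image_range₂ {α β X Y : Type*} (f : X → Y) {F : α → β → X} {G : α → β → Y}
    (h : ∀ k j, f (F k j) = G k j) :
    f '' {x | ∃ k j, x = F k j} = {y | ∃ k j, y = G k j} := by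
  ext y
  constructor
  · rintro ⟨_, ⟨k, j, rfl⟩, rfl⟩
    exact ⟨k, j, h k j⟩
  · rintro ⟨k, j, rfl⟩
    exact ⟨_, ⟨k, j, rfl⟩, h k j⟩

theorem IsTensorRep.image_generators (h : IsTensorRep D (Uh.sumEquiv D hn) T S)
    (huw : ∀ i, restrictWord i u = w i) :
    (Uh.sumEquiv D hn).toAlgHom ''
      ({x | ∃ k j, x = QG.mPlus (CartanDatum.sum D) u S (Basis.piTensorProduct b) k j} ∪
        {x | ∃ k j, x = QG.mMinus (CartanDatum.sum D) u S (Basis.piTensorProduct b) k j}) =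
      {x | ∃ k j : ∀ i, κ i, x = UhTensor.tprod
        fun i => QG.mPlus (D i) (w i) (T i) (b i) (k i) (j i)} ∪
      {x | ∃ k j : ∀ i, κ i, x = UhTensor.tprod
        fun i => QG.mMinus (D i) (w i) (T i) (b i) (k i) (j i)} := by
  rw [Set.image_union]
  exact congrArg₂ _ (image_range₂ _ fun k j => h.mPlus hn b huw k j)
    (image_range₂ _ fun k j => h.mMinus hn b huw k j)

theorem IsTensorRep.image_UqExt (h : IsTensorRep D (Uh.sumEquiv D hn) T S)
    (huw : ∀ i, restrictWord i u = w i) (K : Subfield (LaurentSeries ℂ)) :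
    Algebra.TensorProduct.map (AlgHom.id (LaurentSeries ℂ) (LaurentSeries ℂ))
        (Uh.sumEquiv D hn).toAlgHom '' (UqExt K (CartanDatum.sum D) u S (Basis.piTensorProduct b) :
          Set (LaurentSeries ℂ ⊗[Kh] Uh (CartanDatum.sum D))) =
      (adjoinField K ({x | ∃ k j : ∀ i, κ i, x = UhTensor.tprod
          fun i => QG.mPlus (D i) (w i) (T i) (b i) (k i) (j i)} ∪
        {x | ∃ k j : ∀ i, κ i, x = UhTensor.tprod
          fun i => QG.mMinus (D i) (w i) (T i) (b i) (k i) (j i)}) :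
        Set (LaurentSeries ℂ ⊗[Kh] UhTensor D)) := by
  have e := congrArg (fun G => (adjoinField K G : Set (LaurentSeries ℂ ⊗[Kh] UhTensor D)))
    (h.image_generators hn b huw)
  have e' := image_adjoinField K (A := Uh (CartanDatum.sum D)) (B := UhTensor D)
    (Uh.sumEquiv D hn).toAlgHom
    ({x | ∃ k j, x = QG.mPlus (CartanDatum.sum D) u S (Basis.piTensorProduct b) k j} ∪
      {x | ∃ k j, x = QG.mMinus (CartanDatum.sum D) u S (Basis.piTensorProduct b) k j})
  exact e'.trans e

end frt

end QG

end

theorem proposition3p3 {n : ℕ} (hn : 0 < n) {ι : Fin n → Type*} [∀ i, Fintype (ι i)]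
    [∀ i, DecidableEq (ι i)] (D : ∀ i, QG.CartanDatum (ι i))
    (w : ∀ i, List (ι i)) (hw : ∀ i, (D i).IsLongest (w i))
    (u : List (Σ i, ι i)) (hu : (QG.CartanDatum.sum D).IsLongest u)
    (huw : ∀ i, QG.restrictWord i u = w i)
    {V : Fin n → Type*} [∀ i, AddCommGroup (V i)] [∀ i, Module QG.Kh (V i)]
    {κ : Fin n → Type*} [∀ i, Finite (κ i)] (b : ∀ i, Module.Basis (κ i) QG.Kh (V i))
    (T : ∀ i, QG.Uh (D i) →ₐ[QG.Kh] Module.End QG.Kh (V i)) :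
    ∃ Φ : QG.Uh (QG.CartanDatum.sum D) ≃ₐ[QG.Kh] QG.UhTensor D,
      QG.IsCanonicalIso D Φ ∧
      (∃! S, QG.IsTensorRep D Φ T S) ∧
      ∀ S, QG.IsTensorRep D Φ T S →
        (∀ k j : ∀ i, κ i,
          Φ (QG.mPlus (QG.CartanDatum.sum D) u S (Basis.piTensorProduct b) k j) =
              QG.UhTensor.tprod (fun i => QG.mPlus (D i) (w i) (T i) (b i) (k i) (j i)) ∧
          Φ (QG.mMinus (QG.CartanDatum.sum D) u S (Basis.piTensorProduct b) k j) =
              QG.UhTensor.tprod (fun i => QG.mMinus (D i) (w i) (T i) (b i) (k i) (j i))) ∧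
        ∀ K : Subfield (LaurentSeries ℂ),
          Algebra.TensorProduct.map (AlgHom.id (LaurentSeries ℂ) (LaurentSeries ℂ)) Φ.toAlgHom ''
              (QG.UqExt K (QG.CartanDatum.sum D) u S (Basis.piTensorProduct b) :
                Set (LaurentSeries ℂ ⊗[QG.Kh] QG.Uh (QG.CartanDatum.sum D))) =
            (QG.adjoinField K
              ({x | ∃ k j : ∀ i, κ i, x = QG.UhTensor.tprod
                  (fun i => QG.mPlus (D i) (w i) (T i) (b i) (k i) (j i))} ∪
                {x | ∃ k j : ∀ i, κ i, x = QG.UhTensor.tprod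
                  (fun i => QG.mMinus (D i) (w i) (T i) (b i) (k i) (j i))}) :
              Set (LaurentSeries ℂ ⊗[QG.Kh] QG.UhTensor D)) := by
  have _ : Module.Free QG.Kh (⨂[QG.Kh] i, V i) := .of_basis (Basis.piTensorProduct b)
  have _ : Module.Finite QG.Kh (⨂[QG.Kh] i, V i) := .of_basis (Basis.piTensorProduct b)
  have hM := QG.isHComplete_of_free (Module.End QG.Kh (⨂[QG.Kh] i, V i))
  obtain ⟨S₀, hS₀⟩ := QG.exists_isTensorRep T hM (QG.Uh.sumEquiv D hn)
  refine ⟨QG.Uh.sumEquiv D hn, QG.Uh.isCanonicalIso_sumEquiv D hn,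
    ⟨S₀, hS₀, fun S hS => QG.IsTensorRep.unique hn T hM hS hS₀⟩, fun S hS =>
    ⟨fun k j => ⟨hS.mPlus hn b huw k j, hS.mMinus hn b huw k j⟩, hS.image_UqExt hn b huw⟩⟩
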